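/- \textbf{Setting.} Let $d\ge 1$, let $\mathcal R\subset\mathbb Z$ be a finite set, let $y_{r,k}\ge 0$ ($r\in\mathcal R$, $1\le k\le d$), let $\varepsilon,\alpha_T,\beta_T\ge 0$, let $K\ge 1$ be an integer, and let $(p_r)_{r\in\mathcal R}$ satisfy $p_r>0$ and $\sum_r p_r=1$. Let $F_{j,k}=e^{-2\pi i jk/d}$, $1\le j,k\le d$, let $\circ$ be the entrywise product, and let $S_r$ be either the circular shift $(S_rv)_j=v_{j-r \bmod d}$ or the noncircular shift $(S_rv)_j=v_{j-r}$ if $1\le j-r\le d$ and $0$ otherwise. For $z,v\in\mathbb C^d$ put \[ \mathcal L_{r}(z,v)=\sum_{k=1}^d\Big[\sqrt{|[F(z\circ S_rv)]_k|^2+\varepsilon}-\sqrt{y_{r,k}+\varepsilon}\Big]^2,\qquad \mathcal J_r=\mathcal L_r+\alpha_Tp_r\|z\|_2^2+\beta_Tp_r\|v\|_2^2,\qquad \mathcal J=\sum_{r\in\mathcal R}\mathcal J_r . \] For $\varepsilon>0$, $\nabla=(\nabla_z,\nabla_v)$ is the Wirtinger gradient, with entries $\tfrac12(\partial_{\mathrm{Re}}+i\,\partial_{\mathrm{Im}})$;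 for $\varepsilon=0$, $\nabla\mathcal J$ and $\nabla\mathcal J_r$ are the pointwise limits of the gradients for $\varepsilon\to0+$. Explicitly, with $\rho_{r,k}=\big(1-\sqrt{y_{r,k}+\varepsilon}\,/\sqrt{|[F(z\circ S_rv)]_k|^2+\varepsilon}\big)[F(z\circ S_rv)]_k$ (equal to $0$ if $\varepsilon=0$ and $[F(z\circ S_rv)]_k=0$), \[ \nabla_z\mathcal J_r=\overline{S_rv}\circ F^*\rho_r+\alpha_Tp_rz,\qquad \nabla_v\mathcal J_r=S_{-r}\big(\overline z\circ F^*\rho_r\big)+\beta_Tp_rv,\qquad \nabla\mathcal J=\sum_{r}\nabla\mathcal J_r . \] Let $r^{t,k}$ ($t\ge0$, $1\le k\le K$) be independent random elements of $\mathcal R$ with $\mathbb P(r^{t,k}=r)=p_r$, and let $\mathcal F_t$ be the $\sigma$-algebra generated by the $r^{s,k}$ with $s<t$. Given deterministic $z^0,v^0\in\mathbb C^d$ and step sizes $\mu_t,\nu_t\ge 0$, stochastic gradient descent is \[ z^{t+1}=z^t-\mu_t\frac1K\sum_{k=1}^K\frac{\nabla_z\mathcal J_{r^{t,k}}(z^t,v^t)}{p_{r^{t,k}}},\qquad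 v^{t+1}=v^t-\nu_t\frac1K\sum_{k=1}^K\frac{\nabla_v\mathcal J_{r^{t,k}}(z^t,v^t)}{p_{r^{t,k}}} . \] Let $\|y/d\|_1=\sum_{r,k}|y_{r,k}|/d$ and \[ B(z,v)=3d\big[\tfrac{10}3\|z\|_2^2+\tfrac{10}3\|v\|_2^2+\|y/d\|_1^{1/2}\big]+3\max\{\alpha_T,\beta_T\}, \] \[ B_z(z,v)=(\tfrac{15}4d)^{1/2}\Big[\frac{d\|v\|_2}{\sqrt K\min_rp_r}\big(\|z\|_2\|v\|_2+\|y/d\|_1^{1/2}\big)+\alpha_T\|z\|_2\Big], \] \[ B_v(z,v)=(\tfrac{15}4d)^{1/2}\Big[\frac{d\|z\|_2}{\sqrt K\min_rp_r}\big(\|z\|_2\|v\|_2+\|y/d\|_1^{1/2}\big)+\beta_T\|v\|_2\Big]. \] For $0\le\theta<1$ and $\kappa<\theta/(1+\theta)$ put \[ \mu_t^{\max}=\min\Big\{(1+t)^{-1+\kappa}B(z^t,v^t)^{-\frac1{1-\theta}},\ B_z(z^t,v^t)^{-\frac2{3-\theta}},\ B_v(z^t,v^t)^{-\frac2{3-\theta}},\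 (1-\tfrac1K)^{-1/\theta}\Big\}, \] where a negative power of $0$ is $+\infty$ (such a term does not count in the minimum), and the last term is $+\infty$ if $\theta=0$. \textbf{Theorem.} \begin{enumerate} \item If $\mu_t,\nu_t\ge0$ are adapted to $(\mathcal F_t)_{t\ge0}$ and $\mu_t,\nu_t\le\mu_t^{\max}$ for all $t$, then $\mathcal J(z^t,v^t)$ converges (to a finite limit) almost surely. \item If $\alpha_T,\beta_T,\theta>0$, $\kappa\ge0$, and $\mu_t=\mu\,\mu_t^{\max}$, $\nu_t=\nu\,\mu_t^{\max}$ with constants $0<\mu,\nu\le1$, then there is a finite random variable $C_2$ such that almost surely, for all $T\ge1$, \[ \min_{t=0,\dots,T-1}\|\nabla\mathcal J(z^t,v^t)\|_2^2\le\begin{cases}\dfrac{\kappa\,C_2}{\min\{\mu,\nu\}\,[(1+T)^\kappa-1]},&\kappa>0,\\[2mm]\dfrac{C_2}{\min\{\mu,\nu\}\,\ln(1+T)},&\kappa=0,\end{cases} \] and $\inf_{t\ge0}\|\nabla\mathcal J(z^t,v^t)\|_2^2=0$ almost surely. \item If, in addition to the assumptions of 2, $\varepsilon>0$, then $\|\nabla\mathcal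 J(z^t,v^t)\|_2\to0$ as $t\to\infty$ almost surely. \end{enumerate} -/

import Mathlib

open MeasureTheory ProbabilityTheory Filter Topology
open scoped ENNReal Matrix

noncomputable section

namespace Ptycho

/-- The space `ℂ^d` with its Euclidean norm; position `j : Fin d` stands for the index `j + 1`
in `{1, …, d}`. -/
abbrev Vec (d : ℕ) := EuclideanSpace ℂ (Fin d)

/-- The shift `S_r`: circular, `(S_r v)_j = v_{j - r mod d}`, or noncircular,
`(S_r v)_j = v_{j - r}` when `j - r` is an index and `0` otherwise. -/
def shift {d : ℕ} (circular : Bool) (r : ℤ) (v : Vec d) : Vec d :=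
  WithLp.toLp 2 fun j : Fin d =>
    if circular = true then
      v ⟨(((j : ℤ) - r) % (d : ℤ)).toNat, by
        have hd : (0 : ℤ) < d := by have := j.isLt; omega
        have h1 := Int.emod_nonneg ((j : ℤ) - r) hd.ne'
        have h2 := Int.emod_lt_of_pos ((j : ℤ) - r) hd
        omega⟩
    else if h : 0 ≤ (j : ℤ) - r ∧ (j : ℤ) - r < d then
      v ⟨((j : ℤ) - r).toNat, by omega⟩
    else 0

/-- The discrete Fourier matrix `F_{j,k} = exp(-2πi jk/d)`, `j, k = 1, …, d`. -/
def dft (d : ℕ) : Matrix (Fin d) (Fin d) ℂ := fun j k =>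
  Complex.exp (-2 * (Real.pi : ℂ) * Complex.I * ((j : ℂ) + 1) * ((k : ℂ) + 1) / (d : ℂ))

/-- The data of the problem: type of shift, set `R` of shift positions, measurements `y_{r,k}`,
sampling weights `p_r`, batch size `K`, smoothing `ε`, and Tikhonov parameters
`αT`, `βT`. -/
structure Model (d : ℕ) where
  circular : Bool
  R : Finset ℤ
  y : R → Fin d → ℝ
  p : R → ℝ
  K : ℕ
  ε : ℝ
  αT : ℝ
  βT : ℝ

variable {d : ℕ} (M : Model d)

/-- `F (z ∘ S_r v)`. -/
def farField (r : M.R) (z v : Vec d) : Fin d → ℂ :=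
  dft d *ᵥ fun j => z j * shift M.circular (r : ℤ) v j

/-- The loss `L_{r,ε}` of one region. -/
def lossR (r : M.R) (z v : Vec d) : ℝ :=
  ∑ k, (√(‖farField M r z v k‖ ^ 2 + M.ε) - √(M.y r k + M.ε)) ^ 2

/-- The loss `L_ε`. -/
def loss (z v : Vec d) : ℝ := ∑ r : M.R, lossR M r z v

/-- The regularized loss `J`. -/
def J (z v : Vec d) : ℝ := loss M z v + M.αT * ‖z‖ ^ 2 + M.βT * ‖v‖ ^ 2

/-- `J_r = L_{r,ε} + αT p_r ‖z‖² + βT p_r ‖v‖²`. -/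
def JR (r : M.R) (z v : Vec d) : ℝ :=
  lossR M r z v + M.αT * M.p r * ‖z‖ ^ 2 + M.βT * M.p r * ‖v‖ ^ 2

/-- The vector `[I - diag(√(y_{r,k} + ε) / √(|[F (z ∘ S_r v)]_k|² + ε))] F (z ∘ S_r v)`. If `ε = 0`
and `[F (z ∘ S_r v)]_k = 0`, then its `k`-th entry is `0`. -/
def residual (r : M.R) (z v : Vec d) : Fin d → ℂ := fun k =>
  ((1 - √(M.y r k + M.ε) / √(‖farField M r z v k‖ ^ 2 + M.ε) : ℝ) : ℂ) * farField M r z v k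

/-- `∇_z L_{r,ε} = diag(conj (S_r v)) F^* residual`. -/
def gradZLossR (r : M.R) (z v : Vec d) : Vec d :=
  WithLp.toLp 2 fun j =>
    star (shift M.circular (r : ℤ) v j) * ((dft d)ᴴ *ᵥ residual M r z v) j

/-- `∇_v L_{r,ε} = S_{-r} diag(conj z) F^* residual`. -/
def gradVLossR (r : M.R) (z v : Vec d) : Vec d :=
  shift M.circular (-(r : ℤ))
    (WithLp.toLp 2 fun j => star (z j) * ((dft d)ᴴ *ᵥ residual M r z v) j)

/-- `∇_z J`. -/
def gradZ (z v : Vec d) : Vec d := ∑ r : M.R, gradZLossR M r z v + (M.αT : ℂ) • z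

/-- `∇_v J`. -/
def gradV (z v : Vec d) : Vec d := ∑ r : M.R, gradVLossR M r z v + (M.βT : ℂ) • v

/-- `∇J = (∇_z J, ∇_v J)`, with the Euclidean norm of `ℂ^{2d}`. -/
def grad (z v : Vec d) : WithLp 2 (Vec d × Vec d) := WithLp.toLp 2 (gradZ M z v, gradV M z v)

/-- `∇_z J_r`. -/
def gradZR (r : M.R) (z v : Vec d) : Vec d := gradZLossR M r z v + ((M.αT * M.p r : ℝ) : ℂ) • z

/-- `∇_v J_r`. -/
def gradVR (r : M.R) (z v : Vec d) : Vec d := gradVLossR M r z v + ((M.βT * M.p r : ℝ) : ℂ) • v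

/-- The `z`-part of the stochastic gradient for the sampled positions `s 1, …, s K`. -/
def stochGradZ (s : Fin M.K → M.R) (z v : Vec d) : Vec d :=
  ((1 / (M.K : ℝ) : ℝ) : ℂ) • ∑ k, ((1 / M.p (s k) : ℝ) : ℂ) • gradZR M (s k) z v

/-- The `v`-part of the stochastic gradient. -/
def stochGradV (s : Fin M.K → M.R) (z v : Vec d) : Vec d :=
  ((1 / (M.K : ℝ) : ℝ) : ℂ) • ∑ k, ((1 / M.p (s k) : ℝ) : ℂ) • gradVR M (s k) z v

/-- `‖y/d‖₁`. -/
def yNorm : ℝ := ∑ r : M.R, ∑ k, |M.y r k / (d : ℝ)|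

/-- `min_{r ∈ R} p_r`. -/
def pMin : ℝ := ⨅ r : M.R, M.p r

def B (z v : Vec d) : ℝ :=
  3 * (d : ℝ) * (10 / 3 * ‖z‖ ^ 2 + 10 / 3 * ‖v‖ ^ 2 + √(yNorm M)) + 3 * max M.αT M.βT

def Bz (z v : Vec d) : ℝ :=
  √(15 / 4 * (d : ℝ)) *
    ((d : ℝ) * ‖v‖ / (√(M.K : ℝ) * pMin M) * (‖z‖ * ‖v‖ + √(yNorm M)) + M.αT * ‖z‖)

def Bv (z v : Vec d) : ℝ :=
  √(15 / 4 * (d : ℝ)) *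
    ((d : ℝ) * ‖z‖ / (√(M.K : ℝ) * pMin M) * (‖z‖ * ‖v‖ + √(yNorm M)) + M.βT * ‖v‖)

/-- The term `(1 - 1/K)^{-1/θ}`; it is `∞`, that is, it imposes no bound, if `K = 1` or
`θ = 0`. -/
def batchBound (K : ℕ) (θ : ℝ) : ℝ≥0∞ :=
  if θ = 0 then ∞ else ENNReal.ofReal (1 - 1 / (K : ℝ)) ^ (-(1 / θ))

/-- The maximal step size at time `t` in the point `(z, v)`. A negative power of `0` is `∞`
in `ℝ≥0∞`, so that terms with denominator `0` do not count in the minimum. -/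
def stepMax (θ κ : ℝ) (t : ℕ) (z v : Vec d) : ℝ≥0∞ :=
  min (ENNReal.ofReal ((1 + (t : ℝ)) ^ (-1 + κ)) * ENNReal.ofReal (B M z v) ^ (-(1 / (1 - θ))))
    (min (ENNReal.ofReal (Bz M z v) ^ (-(2 / (3 - θ))))
      (min (ENNReal.ofReal (Bv M z v) ^ (-(2 / (3 - θ)))) (batchBound M.K θ)))

/-- The Wirtinger gradient, `(∂f/∂Re x_j + i ∂f/∂Im x_j) / 2`. -/
def wirtinger (f : Vec d → ℝ) (x : Vec d) : Vec d :=
  WithLp.toLp 2 fun j =>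
    ((fderiv ℝ f x (EuclideanSpace.single j 1) : ℝ) +
      Complex.I * (fderiv ℝ f x (EuclideanSpace.single j Complex.I) : ℝ)) / 2

theorem wirtinger_of_hasFDerivAt {f : Vec d → ℝ} {x g : Vec d} {f' : Vec d →L[ℝ] ℝ}
    (hf : HasFDerivAt f f' x) (h : ∀ u, f' u = 2 * (∑ j, star (g j) * u j).re) :
    wirtinger f x = g := by
  ext j
  simp only [wirtinger, hf.fderiv, h]
  apply Complex.ext <;> simp

/-- The derivative of an amplitude loss. -/
theorem hasFDerivAt_amp (a : Fin d → Fin d → ℂ) (y : Fin d → ℝ) {ε : ℝ} (hε : 0 < ε) (x : Vec d) :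
    ∃ f' : Vec d →L[ℝ] ℝ, HasFDerivAt (fun x : Vec d =>
      ∑ k, (√(‖∑ j, a k j * x j‖ ^ 2 + ε) - √(y k + ε)) ^ 2) f' x ∧
      ∀ u, f' u = 2 * (∑ k, star (((1 - √(y k + ε) / √(‖∑ j, a k j * x j‖ ^ 2 + ε) : ℝ) : ℂ) *
        ∑ j, a k j * x j) * ∑ j, a k j * u j).re := by
  have key : ∀ k, HasFDerivAt (fun x : Vec d => ∑ j, a k j * x j)
      (∑ j, a k j • ((EuclideanSpace.proj j : Vec d →L[ℂ] ℂ).restrictScalars ℝ)) x := by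
    intro k
    apply HasFDerivAt.fun_sum
    intro j _
    exact ((EuclideanSpace.proj j : Vec d →L[ℂ] ℂ).restrictScalars ℝ).hasFDerivAt.const_mul (a k j)
  have key2 := fun k => ((((key k).norm_sq.add_const ε).sqrt
    (by positivity)).sub_const (√(y k + ε))).pow 2
  refine ⟨_, HasFDerivAt.fun_sum fun k _ => key2 k, ?_⟩
  intro u
  rw [sum_apply, Complex.re_sum, Finset.mul_sum]
  refine Finset.sum_congr rfl fun k _ => ?_
  have hw : (∑ j, a k j • ((EuclideanSpace.proj j : Vec d →L[ℂ] ℂ).restrictScalars ℝ)) u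
      = ∑ j, a k j * u j := by simp [sum_apply]
  have hs : √(‖∑ j, a k j * x j‖ ^ 2 + ε) ≠ 0 := by positivity
  simp only [smul_apply, ContinuousLinearMap.comp_apply, hw]
  generalize (∑ j, a k j * u j) = b at *
  generalize (∑ j, a k j * x j) = c at *
  simp [Complex.inner]
  field_simp

theorem shift_eq_sum (c : Bool) (r : ℤ) (v : Vec d) (j : Fin d) :
    shift c r v j = ∑ k : Fin d,
      if (if c = true then (d : ℤ) ∣ j - r - k else (j : ℤ) - r = k) then v k else 0 := by
  have hd : (0 : ℤ) < d := by have := j.isLt; omega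
  unfold shift
  cases c
  · by_cases h : 0 ≤ (j : ℤ) - r ∧ (j : ℤ) - r < d
    · simp only [Bool.false_eq_true, if_false, dif_pos h]
      rw [Finset.sum_eq_single ⟨((j : ℤ) - r).toNat, by omega⟩]
      · rw [if_pos]
        simp only
        omega
      · intro k _ hk
        rw [if_neg]
        intro h'
        apply hk
        ext
        simp only
        omega
      · simp
    · simp only [Bool.false_eq_true, if_false, dif_neg h]
      rw [Finset.sum_eq_zero]
      intro k _
      rw [if_neg]
      have := k.isLt
      omega
  · simp only [if_true]
    have h1 := Int.emod_nonneg ((j : ℤ) - r) hd.ne'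
    have h2 := Int.emod_lt_of_pos ((j : ℤ) - r) hd
    rw [Finset.sum_eq_single ⟨(((j : ℤ) - r) % (d : ℤ)).toNat, by omega⟩]
    · rw [if_pos]
      simp only [Int.toNat_of_nonneg h1]
      exact Int.dvd_self_sub_emod
    · intro k _ hk
      rw [if_neg]
      intro h'
      apply hk
      ext
      have h3 : ((j : ℤ) - r) % d = (k : ℤ) % d :=
        Int.emod_eq_emod_iff_emod_sub_eq_zero.2 (Int.emod_eq_zero_of_dvd h')
      have h4 : (k : ℤ) % d = k := Int.emod_eq_of_lt (by omega) (by have := k.isLt; omega)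
      simp only
      omega
    · simp

theorem sum_mul_shift (c : Bool) (r : ℤ) (x : Fin d → ℂ) (v : Vec d) :
    ∑ j, x j * shift c r v j = ∑ j, shift c (-r) (WithLp.toLp 2 x) j * v j := by
  simp only [shift_eq_sum, Finset.mul_sum, Finset.sum_mul]
  rw [Finset.sum_comm]
  refine Finset.sum_congr rfl fun j _ => Finset.sum_congr rfl fun k _ => ?_
  have h : (if c = true then (d : ℤ) ∣ k - r - j else (k : ℤ) - r = j) ↔
      (if c = true then (d : ℤ) ∣ j - -r - k else (j : ℤ) - -r = k) := by
    cases c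
    · simp only [Bool.false_eq_true, if_false]
      omega
    · simp only [if_true]
      rw [← dvd_neg]
      ring_nf
  simp only [h]
  split_ifs <;> simp

theorem star_shift (c : Bool) (r : ℤ) (x : Vec d) (j : Fin d) :
    star (shift c r x j) = shift c r (WithLp.toLp 2 fun j => star (x j)) j := by
  unfold shift
  cases c
  · by_cases h : 0 ≤ (j : ℤ) - r ∧ (j : ℤ) - r < d
    · simp only [Bool.false_eq_true, if_false, dif_pos h]
    · simp only [Bool.false_eq_true, if_false, dif_neg h, star_zero]
  · simp

theorem farField_apply (r : M.R) (z v : Vec d) (k : Fin d) :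
    farField M r z v k = ∑ j, dft d k j * (z j * shift M.circular (r : ℤ) v j) := rfl

theorem hasFDerivAt_lossR_z (hε : 0 < M.ε) (r : M.R) (z v : Vec d) :
    ∃ f' : Vec d →L[ℝ] ℝ, HasFDerivAt (fun z => lossR M r z v) f' z ∧
      ∀ u, f' u = 2 * (∑ j, star (gradZLossR M r z v j) * u j).re := by
  obtain ⟨f', h1, h2⟩ := hasFDerivAt_amp
    (fun k j => dft d k j * shift M.circular (r : ℤ) v j) (M.y r) hε z
  have hf : ∀ x k, ∑ j, dft d k j * shift M.circular (r : ℤ) v j * x j = farField M r x v k := by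
    intro x k
    rw [farField_apply]
    exact Finset.sum_congr rfl fun j _ => by ring
  simp only [hf] at h1 h2
  refine ⟨f', h1, fun u => ?_⟩
  rw [h2]
  congr 2
  simp only [gradZLossR, star_mul', star_star, Matrix.mulVec, dotProduct, star_sum,
    Matrix.conjTranspose_apply, Finset.mul_sum, Finset.sum_mul, farField_apply M r u]
  rw [Finset.sum_comm]
  refine Finset.sum_congr rfl fun j _ => Finset.sum_congr rfl fun k _ => ?_
  simp only [residual, star_mul']
  ring

theorem hasFDerivAt_lossR_v (hε : 0 < M.ε) (r : M.R) (z v : Vec d) :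
    ∃ f' : Vec d →L[ℝ] ℝ, HasFDerivAt (fun v => lossR M r z v) f' v ∧
      ∀ u, f' u = 2 * (∑ j, star (gradVLossR M r z v j) * u j).re := by
  obtain ⟨f', h1, h2⟩ := hasFDerivAt_amp
    (fun k j => shift M.circular (-(r : ℤ)) (WithLp.toLp 2 fun i => dft d k i * z i) j)
    (M.y r) hε v
  have hf : ∀ x k, ∑ j, shift M.circular (-(r : ℤ)) (WithLp.toLp 2 fun i => dft d k i * z i) j * x j
      = farField M r z x k := by
    intro x k
    rw [farField_apply, ← sum_mul_shift]
    exact Finset.sum_congr rfl fun j _ => by ring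
  simp only [hf] at h1 h2
  refine ⟨f', h1, fun u => ?_⟩
  rw [h2]
  congr 2
  simp only [gradVLossR, star_shift, ← sum_mul_shift]
  simp only [star_mul', star_star, Matrix.mulVec, dotProduct, star_sum,
    Matrix.conjTranspose_apply, Finset.mul_sum, Finset.sum_mul, farField_apply M r z u]
  rw [Finset.sum_comm]
  refine Finset.sum_congr rfl fun j _ => Finset.sum_congr rfl fun k _ => ?_
  simp only [residual, star_mul']
  ring

theorem hasFDerivAt_norm_sq (a : ℝ) (z : Vec d) :
    ∃ f' : Vec d →L[ℝ] ℝ, HasFDerivAt (fun z : Vec d => a * ‖z‖ ^ 2) f' z ∧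
      ∀ u, f' u = 2 * (∑ j, star (((a : ℂ) • z) j) * u j).re := by
  refine ⟨_, ((hasFDerivAt_id z).norm_sq).const_mul a, fun u => ?_⟩
  have h : (inner ℝ z u : ℝ) = (∑ j, star (z j) * u j).re := by
    rw [PiLp.inner_apply, Complex.re_sum]
    refine Finset.sum_congr rfl fun j _ => ?_
    simp [Complex.inner]
    ring
  have h2 : ∑ j, star (((a : ℂ) • z) j) * u j = (a : ℂ) * ∑ j, star (z j) * u j := by
    rw [Finset.mul_sum]
    refine Finset.sum_congr rfl fun j _ => ?_
    simp [mul_assoc]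
  rw [h2, Complex.re_ofReal_mul, ← h]
  simp
  ring

/-- For `ε > 0` the functions `J` and `J_r` are differentiable and `gradZ`, `gradV`, `gradZR`,
`gradVR` are their Wirtinger gradients. -/
theorem wirtinger_J_z (hε : 0 < M.ε) (z v : Vec d) :
    DifferentiableAt ℝ (fun z => J M z v) z ∧ wirtinger (fun z => J M z v) z = gradZ M z v := by
  choose f' h1 h2 using fun r => hasFDerivAt_lossR_z M hε r z v
  obtain ⟨g', h3, h4⟩ := hasFDerivAt_norm_sq M.αT z
  have h5 := ((HasFDerivAt.fun_sum fun r (_ : r ∈ Finset.univ) => h1 r).add h3).add_const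
    (M.βT * ‖v‖ ^ 2)
  refine ⟨h5.differentiableAt, wirtinger_of_hasFDerivAt h5 fun u => ?_⟩
  simp only [add_apply, sum_apply, h2, h4, gradZ, PiLp.add_apply, star_add, add_mul,
    Finset.sum_add_distrib, Complex.add_re, mul_add]
  congr 1
  rw [← Finset.mul_sum, ← Complex.re_sum, Finset.sum_comm]
  congr 2
  refine Finset.sum_congr rfl fun j _ => ?_
  rw [← Finset.sum_mul, ← star_sum]
  simp

theorem wirtinger_J_v (hε : 0 < M.ε) (z v : Vec d) :
    DifferentiableAt ℝ (fun v => J M z v) v ∧ wirtinger (fun v => J M z v) v = gradV M z v := by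
  choose f' h1 h2 using fun r => hasFDerivAt_lossR_v M hε r z v
  obtain ⟨g', h3, h4⟩ := hasFDerivAt_norm_sq M.βT v
  have h5 := ((HasFDerivAt.fun_sum fun r (_ : r ∈ Finset.univ) => h1 r).add_const
    (M.αT * ‖z‖ ^ 2)).add h3
  refine ⟨h5.differentiableAt, wirtinger_of_hasFDerivAt h5 fun u => ?_⟩
  simp only [add_apply, sum_apply, h2, h4, gradV, PiLp.add_apply, star_add, add_mul,
    Finset.sum_add_distrib, Complex.add_re, mul_add]
  congr 1
  rw [← Finset.mul_sum, ← Complex.re_sum, Finset.sum_comm]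
  congr 2
  refine Finset.sum_congr rfl fun j _ => ?_
  rw [← Finset.sum_mul, ← star_sum]
  simp

theorem wirtinger_JR_z (hε : 0 < M.ε) (r : M.R) (z v : Vec d) :
    DifferentiableAt ℝ (fun z => JR M r z v) z ∧
      wirtinger (fun z => JR M r z v) z = gradZR M r z v := by
  obtain ⟨f', h1, h2⟩ := hasFDerivAt_lossR_z M hε r z v
  obtain ⟨g', h3, h4⟩ := hasFDerivAt_norm_sq (M.αT * M.p r) z
  have h5 := (h1.add h3).add_const (M.βT * M.p r * ‖v‖ ^ 2)
  refine ⟨h5.differentiableAt, wirtinger_of_hasFDerivAt h5 fun u => ?_⟩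
  simp only [add_apply, h2, h4, gradZR, PiLp.add_apply, star_add, add_mul,
    Finset.sum_add_distrib, Complex.add_re, mul_add]

theorem wirtinger_JR_v (hε : 0 < M.ε) (r : M.R) (z v : Vec d) :
    DifferentiableAt ℝ (fun v => JR M r z v) v ∧
      wirtinger (fun v => JR M r z v) v = gradVR M r z v := by
  obtain ⟨f', h1, h2⟩ := hasFDerivAt_lossR_v M hε r z v
  obtain ⟨g', h3, h4⟩ := hasFDerivAt_norm_sq (M.βT * M.p r) v
  have h5 := (h1.add_const (M.αT * M.p r * ‖z‖ ^ 2)).add h3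
  refine ⟨h5.differentiableAt, wirtinger_of_hasFDerivAt h5 fun u => ?_⟩
  simp only [add_apply, h2, h4, gradVR, PiLp.add_apply, star_add, add_mul,
    Finset.sum_add_distrib, Complex.add_re, mul_add]

theorem sum_JR (hp : ∑ r, M.p r = 1) (z v : Vec d) : ∑ r, JR M r z v = J M z v := by
  simp only [JR, J, loss, Finset.sum_add_distrib, ← Finset.sum_mul, ← Finset.mul_sum, hp, mul_one]

/-- For `ε = 0` the residual, and hence every gradient above, is the limit for `ε → 0+`. -/
theorem tendsto_residual (hε : M.ε = 0) (r : M.R) (z v : Vec d) :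
    Tendsto (fun e => residual { M with ε := e } r z v) (𝓝[>] 0) (𝓝 (residual M r z v)) := by
  rw [tendsto_pi_nhds]
  intro k
  have hw : ∀ e, farField { M with ε := e } r z v = farField M r z v := fun _ => rfl
  simp only [residual, hw]
  rcases eq_or_ne (farField M r z v k) 0 with h | h
  · simp [h]
  · have h1 : √(‖farField M r z v k‖ ^ 2 + M.ε) ≠ 0 := by
      rw [hε]
      have := norm_pos_iff.2 h
      positivity
    have h2 : ContinuousAt (fun e : ℝ => ((1 - √(M.y r k + e) /
        √(‖farField M r z v k‖ ^ 2 + e) : ℝ) : ℂ) * farField M r z v k) M.ε := by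
      refine ContinuousAt.mul ?_ continuousAt_const
      refine Complex.continuous_ofReal.continuousAt.comp (f := fun e : ℝ => 1 - √(M.y r k + e) /
        √(‖farField M r z v k‖ ^ 2 + e)) ?_
      refine continuousAt_const.sub (ContinuousAt.div ?_ ?_ h1)
      · fun_prop
      · fun_prop
    have h3 := h2.tendsto
    rw [hε] at h3 ⊢
    exact h3.mono_left nhdsWithin_le_nhds

section Iteration

variable {Ω : Type*}

/-- The σ-algebra `F_t` generated by the samples `r^{s,k}` with `s < t`. -/
abbrev pastAlgebra (r : ℕ → Fin M.K → Ω → M.R) (t : ℕ) : MeasurableSpace Ω :=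
  ⨆ s : Fin t, ⨆ k : Fin M.K, MeasurableSpace.comap (r s k) ⊤

/-- The samples `r^{t,k}` are independent and have distribution `p`. -/
structure IsSampling [MeasurableSpace Ω] (P : Measure Ω) (r : ℕ → Fin M.K → Ω → M.R) : Prop where
  measurable : ∀ t k, Measurable (r t k)
  indep : iIndepFun (fun i : ℕ × Fin M.K => r i.1 i.2) P
  law : ∀ t k ρ, P {ω | r t k ω = ρ} = ENNReal.ofReal (M.p ρ)

/-- `z^t, v^t` are the iterates of stochastic gradient descent with samples `r^{t,k}`, step sizes
`μ_t, ν_t`, and starting point `(z₀, v₀)`. -/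
structure IsSGD (r : ℕ → Fin M.K → Ω → M.R) (μ ν : ℕ → Ω → ℝ) (z₀ v₀ : Vec d)
    (z v : ℕ → Ω → Vec d) : Prop where
  z_zero : ∀ ω, z 0 ω = z₀
  v_zero : ∀ ω, v 0 ω = v₀
  z_succ : ∀ t ω, z (t + 1) ω =
    z t ω - (μ t ω : ℂ) • stochGradZ M (fun k => r t k ω) (z t ω) (v t ω)
  v_succ : ∀ t ω, v (t + 1) ω =
    v t ω - (ν t ω : ℂ) • stochGradV M (fun k => r t k ω) (z t ω) (v t ω)

end Iteration

end Ptycho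

end

noncomputable section

namespace Ptycho

variable {d : ℕ} {M : Model d}

/-! Since `√(|w|² + ε)` is convex in `w`, an amplitude loss lies below its first-order expansion
plus `|h|²`, with a constant that does not depend on `ε` and survives the nonsmooth point of `ε = 0`
(`amp_add_le`). The far field is bilinear in `(z, v)`, which turns this into a second-order upper
bound for `J` (`J_add_le`). The quantity `B` dominates `‖z‖²`, `‖v‖²` and the parameters; `J` is at
most a multiple of `B²`, and all gradients are at most multiples of `√B √J`. Hence a step with step
sizes at most `m` changes `J` by a linear term plus at most `C ((mB)² + (mB)⁴) J`
(`exists_J_step_le`).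

The stochastic gradient is unbiased, so the linear term has conditional mean `-2μ‖∇_z J‖² - 2ν‖∇_v
J‖²`. Where `B` stays above some `b₀ > 0`, the step size bound gives `mB ≤ C (1 + t)^{-1+κ}`, which
is square summable because `κ < 1/2`. There `J` is an almost supermartingale, and the
Robbins–Siegmund theorem (`ae_tendsto_and_summable_of_condExp_le`) applies.

`B` can approach `0` only if data and regularization both vanish; then the bounds through `Bz` and
`Bv` force the next value of `J` to be small (`exists_B_threshold`). For the first claim
Robbins–Siegmund is therefore applied to the squared positive part of `J - η`, which such a step
sends to `0`. Convergence for every `η = 1/(n+1)` yields convergence of `J`.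

With positive regularization, `B ≥ αT`, so the weighted squared gradients are summable as well.
Convergence of `J` bounds the path, a bounded path has step sizes comparable to `(1 + t)^{-1+κ}`,
and the divergence of the sum of these weights gives the rate and the zero infimum. For `ε > 0` the
gradient is Lipschitz along the path and moves slowly compared with the weights, so it tends to `0`
(`tendsto_zero_of_summable_weighted_sq`).

Measurability and integrability come from finiteness: everything at time `t` is a function of
finitely many samples from a finite set (`DependsOnPast`). -/

/-- The standing assumptions on the data of the problem. -/
structure Model.Admissible (M : Model d) : Prop where
  d_pos : 0 < d
  y_nonneg : ∀ r k, 0 ≤ M.y r k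
  p_pos : ∀ r, 0 < M.p r
  p_sum : ∑ r, M.p r = 1
  K_pos : 0 < M.K
  ε_nonneg : 0 ≤ M.ε
  αT_nonneg : 0 ≤ M.αT
  βT_nonneg : 0 ≤ M.βT

/-! ### The amplitude loss of a single measurement -/

/-- The function `w ↦ √(‖w‖² + ε)` lies above its tangents. -/
theorem sqrt_norm_sq_add_le (w h : ℂ) {ε : ℝ} (hε : 0 ≤ ε) :
    √(‖w‖ ^ 2 + ε) + (star w * h).re / √(‖w‖ ^ 2 + ε) ≤ √(‖w + h‖ ^ 2 + ε) := by
  rcases eq_or_ne (√(‖w‖ ^ 2 + ε)) 0 with h0 | h0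
  · simp [h0]
  have ha : 0 < √(‖w‖ ^ 2 + ε) := lt_of_le_of_ne (Real.sqrt_nonneg _) h0.symm
  have hA : 0 ≤ ‖w‖ ^ 2 + ε := by positivity
  have hsq : √(‖w‖ ^ 2 + ε) ^ 2 = ‖w‖ ^ 2 + ε := Real.sq_sqrt hA
  have hexp : ‖w + h‖ ^ 2 = ‖w‖ ^ 2 + 2 * (star w * h).re + ‖h‖ ^ 2 := by
    simp only [Complex.sq_norm, Complex.normSq_apply, Complex.add_re, Complex.add_im,
      Complex.mul_re, Complex.star_def, Complex.conj_re, Complex.conj_im]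
    ring
  have hR : (star w * h).re ^ 2 ≤ ‖w‖ ^ 2 * ‖h‖ ^ 2 := by
    have := Complex.abs_re_le_norm (star w * h)
    rw [norm_mul, norm_star] at this
    rw [← mul_pow]
    exact sq_le_sq' (neg_le_of_abs_le this) (le_of_abs_le this)
  -- Cauchy–Schwarz for the vectors `(w, √ε)` and `(w + h, √ε)`.
  have key : √(‖w‖ ^ 2 + ε) ^ 2 + (star w * h).re ≤ √(‖w + h‖ ^ 2 + ε) * √(‖w‖ ^ 2 + ε) := by
    rw [← Real.sqrt_mul (by positivity), hsq]
    apply Real.le_sqrt_of_sq_le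
    rw [hexp]
    nlinarith [mul_nonneg hε (sq_nonneg ‖h‖)]
  rw [← mul_le_mul_iff_left₀ ha, add_mul, div_mul_cancel₀ _ h0]
  linarith

/-- Expand the squares: `√(‖w + h‖² + ε)²` is exactly quadratic in `h`, and the cross term is a
nonpositive multiple of a function that lies above its tangents. This is why the curvature constant
is `1` for every `ε ≥ 0`. -/
theorem amp_add_le (w h : ℂ) {y ε : ℝ} (hε : 0 ≤ ε) :
    (√(‖w + h‖ ^ 2 + ε) - √(y + ε)) ^ 2 ≤ (√(‖w‖ ^ 2 + ε) - √(y + ε)) ^ 2 +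
      2 * (star (((1 - √(y + ε) / √(‖w‖ ^ 2 + ε) : ℝ) : ℂ) * w) * h).re + ‖h‖ ^ 2 := by
  have h1 := sqrt_norm_sq_add_le w h hε
  have h2 : √(‖w‖ ^ 2 + ε) ^ 2 = ‖w‖ ^ 2 + ε := Real.sq_sqrt (by positivity)
  have h3 : √(‖w + h‖ ^ 2 + ε) ^ 2 = ‖w + h‖ ^ 2 + ε := Real.sq_sqrt (by positivity)
  have hexp : ‖w + h‖ ^ 2 = ‖w‖ ^ 2 + 2 * (star w * h).re + ‖h‖ ^ 2 := by
    simp only [Complex.sq_norm, Complex.normSq_apply, Complex.add_re, Complex.add_im,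
      Complex.mul_re, Complex.star_def, Complex.conj_re, Complex.conj_im]
    ring
  have h4 : ∀ t : ℝ, (star ((t : ℂ) * w) * h).re = t * (star w * h).re := by
    intro t
    rw [star_mul', Complex.star_def, Complex.conj_ofReal, mul_assoc, Complex.re_ofReal_mul]
  rw [h4]
  have h5 := mul_le_mul_of_nonneg_left h1 (Real.sqrt_nonneg (y + ε))
  rw [mul_add, mul_div_assoc'] at h5
  rw [sub_mul, div_mul_eq_mul_div]
  nlinarith

/-- Follows from `‖w‖² ≤ ‖w‖² + ε`. It lets every gradient bound carry a factor `√loss`. -/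
theorem norm_amp_residual_sq_le (w : ℂ) (c : ℝ) {ε : ℝ} (hε : 0 ≤ ε) :
    ‖((1 - c / √(‖w‖ ^ 2 + ε) : ℝ) : ℂ) * w‖ ^ 2 ≤ (√(‖w‖ ^ 2 + ε) - c) ^ 2 := by
  rw [norm_mul, mul_pow, Complex.norm_real, Real.norm_eq_abs, sq_abs]
  have h2 : √(‖w‖ ^ 2 + ε) ^ 2 = ‖w‖ ^ 2 + ε := Real.sq_sqrt (by positivity)
  rcases eq_or_ne (√(‖w‖ ^ 2 + ε)) 0 with h0 | h0
  · have : ‖w‖ ^ 2 = 0 := by rw [h0] at h2; nlinarith [sq_nonneg ‖w‖]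
    rw [this, mul_zero]
    positivity
  · calc (1 - c / √(‖w‖ ^ 2 + ε)) ^ 2 * ‖w‖ ^ 2
        ≤ (1 - c / √(‖w‖ ^ 2 + ε)) ^ 2 * √(‖w‖ ^ 2 + ε) ^ 2 := by
          rw [h2]; gcongr; linarith
      _ = _ := by field_simp

/-- The two contributions `ε` from the squares are cancelled by the cross term, because the product
of the roots is at least `ε`. -/
theorem amp_le {A Y ε : ℝ} (hA : 0 ≤ A) (hY : 0 ≤ Y) (hε : 0 ≤ ε) :
    (√(A + ε) - √(Y + ε)) ^ 2 ≤ A + Y := by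
  have h1 : √(A + ε) ^ 2 = A + ε := Real.sq_sqrt (by positivity)
  have h2 : √(Y + ε) ^ 2 = Y + ε := Real.sq_sqrt (by positivity)
  have h3 : √ε ^ 2 = ε := Real.sq_sqrt hε
  have h4 : √ε * √ε ≤ √(A + ε) * √(Y + ε) := by gcongr <;> linarith
  nlinarith

/-! ### Norms of shifts, far fields, and gradients -/

theorem norm_le_of_apply_le {x : Vec d} {c : ℝ} (hc : 0 ≤ c) (h : ∀ j, ‖x j‖ ≤ c) :
    ‖x‖ ≤ d * c := by
  rw [EuclideanSpace.norm_eq]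
  apply Real.sqrt_le_iff.2 ⟨by positivity, ?_⟩
  calc ∑ j, ‖x j‖ ^ 2 ≤ ∑ _j : Fin d, c ^ 2 := by gcongr with j; exact h j
    _ = d * c ^ 2 := by simp
    _ ≤ (d * c) ^ 2 := by
      rw [mul_pow]
      gcongr
      rcases Nat.eq_zero_or_pos d with rfl | hd
      · simp
      · exact le_self_pow₀ (by exact_mod_cast hd) (by norm_num)

theorem norm_shift_apply_le {c : Bool} {r : ℤ} {x : Vec d} {b : ℝ} (hb : 0 ≤ b)
    (h : ∀ j, ‖x j‖ ≤ b) (j : Fin d) : ‖shift c r x j‖ ≤ b := by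
  unfold shift
  simp only
  split_ifs
  · exact h _
  · exact h _
  · simpa using hb

theorem shift_add (c : Bool) (r : ℤ) (v w : Vec d) :
    shift c r (v + w) = shift c r v + shift c r w := by
  ext j
  simp only [shift, PiLp.add_apply]
  split_ifs <;> simp

theorem norm_dft (k j : Fin d) : ‖dft d k j‖ = 1 := by
  have : -2 * (Real.pi : ℂ) * Complex.I * ((k : ℂ) + 1) * ((j : ℂ) + 1) / (d : ℂ) =
      ((-2 * Real.pi * ((k : ℝ) + 1) * ((j : ℝ) + 1) / (d : ℝ) : ℝ) : ℂ) * Complex.I := by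
    push_cast
    ring
  rw [dft, this, Complex.norm_exp_ofReal_mul_I]

theorem norm_farField_le (r : M.R) (z v : Vec d) (k : Fin d) :
    ‖farField M r z v k‖ ≤ d * (‖z‖ * ‖v‖) := by
  rw [farField_apply]
  calc _ ≤ ∑ j, ‖dft d k j * (z j * shift M.circular (r : ℤ) v j)‖ := norm_sum_le _ _
    _ ≤ ∑ _j : Fin d, ‖z‖ * ‖v‖ := by
      gcongr with j
      rw [norm_mul, norm_dft, one_mul, norm_mul]
      gcongr
      · exact PiLp.norm_apply_le z j
      · exact norm_shift_apply_le (norm_nonneg _) (PiLp.norm_apply_le v) j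
    _ = _ := by simp

theorem farField_add_left (r : M.R) (z a v : Vec d) (k : Fin d) :
    farField M r (z + a) v k = farField M r z v k + farField M r a v k := by
  simp only [farField_apply, ← Finset.sum_add_distrib, PiLp.add_apply, add_mul, mul_add]

theorem farField_add_right (r : M.R) (z v b : Vec d) (k : Fin d) :
    farField M r z (v + b) k = farField M r z v k + farField M r z b k := by
  simp only [farField_apply, ← Finset.sum_add_distrib, PiLp.add_apply, mul_add, shift_add]

theorem real_inner_eq (x u : Vec d) : (inner ℝ x u : ℝ) = (∑ j, star (x j) * u j).re := by
  rw [PiLp.inner_apply, Complex.re_sum]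
  refine Finset.sum_congr rfl fun j _ => ?_
  simp [Complex.inner]
  ring

/-- The gradient is the adjoint of `u ↦ farField M r u v` applied to the residual, so no
differentiability is involved and `ε = 0` is allowed. -/
theorem sum_residual_mul_farField_left (r : M.R) (z v u : Vec d) :
    (∑ k, star (residual M r z v k) * farField M r u v k).re =
      inner ℝ (gradZLossR M r z v) u := by
  rw [real_inner_eq]
  congr 1
  simp only [gradZLossR, star_mul', star_star, Matrix.mulVec, dotProduct, star_sum,
    Matrix.conjTranspose_apply, Finset.mul_sum, Finset.sum_mul, farField_apply M r u]
  rw [Finset.sum_comm]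
  refine Finset.sum_congr rfl fun j _ => Finset.sum_congr rfl fun k _ => ?_
  ring

/-- As in the first variable; the shift is moved by `sum_mul_shift`, that is, `S_{-r}` is the
transpose of `S_r`. -/
theorem sum_residual_mul_farField_right (r : M.R) (z v u : Vec d) :
    (∑ k, star (residual M r z v k) * farField M r z u k).re =
      inner ℝ (gradVLossR M r z v) u := by
  rw [real_inner_eq]
  congr 1
  simp only [gradVLossR, star_shift, ← sum_mul_shift]
  simp only [star_mul', star_star, Matrix.mulVec, dotProduct, star_sum,
    Matrix.conjTranspose_apply, Finset.mul_sum, Finset.sum_mul, farField_apply M r z u]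
  rw [Finset.sum_comm]
  refine Finset.sum_congr rfl fun j _ => Finset.sum_congr rfl fun k _ => ?_
  ring

theorem lossR_nonneg (r : M.R) (z v : Vec d) : 0 ≤ lossR M r z v :=
  Finset.sum_nonneg fun _ _ => sq_nonneg _

theorem lossR_le_loss (r : M.R) (z v : Vec d) : lossR M r z v ≤ loss M z v :=
  Finset.single_le_sum (f := fun r => lossR M r z v) (fun r _ => lossR_nonneg r z v)
    (Finset.mem_univ r)

theorem loss_nonneg (z v : Vec d) : 0 ≤ loss M z v :=
  Finset.sum_nonneg fun r _ => lossR_nonneg r z v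

theorem yNorm_nonneg : 0 ≤ yNorm M :=
  Finset.sum_nonneg fun _ _ => Finset.sum_nonneg fun _ _ => abs_nonneg _

theorem pMin_le (r : M.R) : pMin M ≤ M.p r :=
  ciInf_le (Set.finite_range _).bddBelow r

namespace Model.Admissible

variable (hM : M.Admissible)
include hM

theorem one_le_d : (1 : ℝ) ≤ d := by exact_mod_cast hM.d_pos

theorem norm_residual_le (r : M.R) (z v : Vec d) (k : Fin d) :
    ‖residual M r z v k‖ ≤ √(loss M z v) := by
  apply Real.le_sqrt_of_sq_le
  refine (norm_amp_residual_sq_le _ _ hM.ε_nonneg).trans (le_trans ?_ (lossR_le_loss r z v))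
  exact Finset.single_le_sum
    (f := fun k => (√(‖farField M r z v k‖ ^ 2 + M.ε) - √(M.y r k + M.ε)) ^ 2)
    (fun k _ => sq_nonneg _) (Finset.mem_univ k)

theorem norm_dftH_residual_le (r : M.R) (z v : Vec d) (j : Fin d) :
    ‖((dft d)ᴴ *ᵥ residual M r z v) j‖ ≤ d * √(loss M z v) := by
  simp only [Matrix.mulVec, dotProduct, Matrix.conjTranspose_apply]
  calc _ ≤ ∑ k, ‖star (dft d k j) * residual M r z v k‖ := norm_sum_le _ _
    _ ≤ ∑ _k : Fin d, √(loss M z v) := by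
      gcongr with k
      rw [norm_mul, norm_star, norm_dft, one_mul]
      exact hM.norm_residual_le r z v k
    _ = _ := by simp

theorem norm_gradZLossR_le (r : M.R) (z v : Vec d) :
    ‖gradZLossR M r z v‖ ≤ d ^ 2 * (‖v‖ * √(loss M z v)) := by
  have : ‖gradZLossR M r z v‖ ≤ d * (‖v‖ * (d * √(loss M z v))) := by
    refine norm_le_of_apply_le (by positivity) fun j => ?_
    simp only [gradZLossR, norm_mul, norm_star]
    gcongr
    · exact norm_shift_apply_le (norm_nonneg _) (PiLp.norm_apply_le v) j
    · exact hM.norm_dftH_residual_le r z v j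
  linarith

theorem norm_gradVLossR_le (r : M.R) (z v : Vec d) :
    ‖gradVLossR M r z v‖ ≤ d ^ 2 * (‖z‖ * √(loss M z v)) := by
  have : ‖gradVLossR M r z v‖ ≤ d * (‖z‖ * (d * √(loss M z v))) := by
    refine norm_le_of_apply_le (by positivity) fun j => ?_
    refine norm_shift_apply_le (by positivity) (fun j => ?_) j
    simp only [norm_mul, norm_star]
    gcongr
    · exact PiLp.norm_apply_le z j
    · exact hM.norm_dftH_residual_le r z v j
  linarith

/-- Bilinearity splits the far field increment into parts linear in `a`, linear in `b`, and the
mixed part `farField M r a b`. Pairing the first two with the residual gives the gradient terms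
exactly; the mixed pairing is of second order and is only estimated, by `√loss`. -/
theorem lossR_add_le (r : M.R) (z v a b : Vec d) :
    lossR M r (z + a) (v + b) ≤ lossR M r z v + 2 * inner ℝ (gradZLossR M r z v) a +
      2 * inner ℝ (gradVLossR M r z v) b + 2 * d ^ 2 * (√(loss M z v) * (‖a‖ * ‖b‖)) +
      d ^ 3 * (‖a‖ * ‖v‖ + ‖z‖ * ‖b‖ + ‖a‖ * ‖b‖) ^ 2 := by
  have hw : ∀ k, farField M r (z + a) (v + b) k = farField M r z v k +
      (farField M r a v k + farField M r z b k + farField M r a b k) := by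
    intro k
    rw [farField_add_left, farField_add_right, farField_add_right]
    ring
  have h1 : ∀ k, (√(‖farField M r (z + a) (v + b) k‖ ^ 2 + M.ε) - √(M.y r k + M.ε)) ^ 2 ≤
      (√(‖farField M r z v k‖ ^ 2 + M.ε) - √(M.y r k + M.ε)) ^ 2 +
      2 * (star (residual M r z v k) * farField M r a v k).re +
      2 * (star (residual M r z v k) * farField M r z b k).re +
      2 * (√(loss M z v) * (d * (‖a‖ * ‖b‖))) +
      (d * (‖a‖ * ‖v‖ + ‖z‖ * ‖b‖ + ‖a‖ * ‖b‖)) ^ 2 := by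
    intro k
    rw [hw]
    refine (amp_add_le _ _ hM.ε_nonneg).trans ?_
    change _ + 2 * (star (residual M r z v k) * _).re + _ ≤ _
    rw [mul_add, mul_add, Complex.add_re, Complex.add_re]
    have h2 : (star (residual M r z v k) * farField M r a b k).re ≤
        √(loss M z v) * (d * (‖a‖ * ‖b‖)) := by
      refine (Complex.re_le_norm _).trans ?_
      rw [norm_mul, norm_star]
      gcongr
      · exact hM.norm_residual_le r z v k
      · exact norm_farField_le r a b k
    have h3 : ‖farField M r a v k + farField M r z b k + farField M r a b k‖ ≤
        d * (‖a‖ * ‖v‖ + ‖z‖ * ‖b‖ + ‖a‖ * ‖b‖) := by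
      refine (norm_add₃_le).trans ?_
      linarith [norm_farField_le r a v k, norm_farField_le r z b k, norm_farField_le r a b k]
    have h4 := pow_le_pow_left₀ (norm_nonneg _) h3 2
    linarith
  refine (Finset.sum_le_sum fun k _ => h1 k).trans ?_
  simp only [Finset.sum_add_distrib, ← Finset.mul_sum, ← Complex.re_sum,
    sum_residual_mul_farField_left, sum_residual_mul_farField_right]
  simp only [Finset.sum_const, Finset.card_univ, Fintype.card_fin, nsmul_eq_mul, lossR]
  apply le_of_eq
  ring

theorem J_add_le (z v a b : Vec d) :
    J M (z + a) (v + b) ≤ J M z v + 2 * inner ℝ (gradZ M z v) a + 2 * inner ℝ (gradV M z v) b +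
      Fintype.card M.R * (2 * d ^ 2 * (√(loss M z v) * (‖a‖ * ‖b‖)) +
        d ^ 3 * (‖a‖ * ‖v‖ + ‖z‖ * ‖b‖ + ‖a‖ * ‖b‖) ^ 2) + M.αT * ‖a‖ ^ 2 + M.βT * ‖b‖ ^ 2 := by
  have h1 : loss M (z + a) (v + b) ≤ _ := Finset.sum_le_sum fun r _ => hM.lossR_add_le r z v a b
  simp only [Finset.sum_add_distrib, ← Finset.mul_sum, ← sum_inner, Finset.sum_const,
    Finset.card_univ, nsmul_eq_mul] at h1
  have hs : ∀ (c : ℝ) (x y : Vec d), inner ℝ ((c : ℂ) • x) y = c * inner ℝ x y := by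
    intro c x y
    rw [real_inner_eq, real_inner_eq, ← Complex.re_ofReal_mul, Finset.mul_sum]
    simp [mul_assoc]
  simp only [J, gradZ, gradV, inner_add_left, hs, norm_add_sq_real]
  change _ ≤ (∑ r : M.R, lossR M r z v) + _ + _ + _ + _ + _ + _ + _
  linarith

theorem loss_le (z v : Vec d) :
    loss M z v ≤ Fintype.card M.R * d ^ 3 * (‖z‖ * ‖v‖) ^ 2 + d * yNorm M := by
  have hd : (d : ℝ) ≠ 0 := by have := hM.one_le_d; positivity
  have h1 : ∀ r k, (√(‖farField M r z v k‖ ^ 2 + M.ε) - √(M.y r k + M.ε)) ^ 2 ≤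
      (d * (‖z‖ * ‖v‖)) ^ 2 + d * |M.y r k / (d : ℝ)| := by
    intro r k
    refine (amp_le (sq_nonneg _) (hM.y_nonneg r k) hM.ε_nonneg).trans ?_
    rw [abs_of_nonneg (div_nonneg (hM.y_nonneg r k) (Nat.cast_nonneg d)), mul_div_cancel₀ _ hd]
    gcongr
    exact norm_farField_le r z v k
  refine (Finset.sum_le_sum fun r _ => Finset.sum_le_sum fun k _ => h1 r k).trans ?_
  simp only [Finset.sum_add_distrib, ← Finset.mul_sum, yNorm]
  simp only [Finset.sum_const, Finset.card_univ, Fintype.card_fin, nsmul_eq_mul]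
  apply le_of_eq
  ring

theorem loss_le_J (z v : Vec d) : loss M z v ≤ J M z v := by
  have := hM.αT_nonneg
  have := hM.βT_nonneg
  unfold J
  have : 0 ≤ M.αT * ‖z‖ ^ 2 := by positivity
  have : 0 ≤ M.βT * ‖v‖ ^ 2 := by positivity
  linarith

theorem J_nonneg (z v : Vec d) : 0 ≤ J M z v := (loss_nonneg z v).trans (hM.loss_le_J z v)

theorem αT_mul_le_J (z v : Vec d) : M.αT * ‖z‖ ^ 2 ≤ J M z v := by
  have := hM.βT_nonneg
  have := loss_nonneg (M := M) z v
  have : 0 ≤ M.βT * ‖v‖ ^ 2 := by positivity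
  unfold J
  linarith

theorem βT_mul_le_J (z v : Vec d) : M.βT * ‖v‖ ^ 2 ≤ J M z v := by
  have := hM.αT_nonneg
  have := loss_nonneg (M := M) z v
  have : 0 ≤ M.αT * ‖z‖ ^ 2 := by positivity
  unfold J
  linarith

/-! ### `B` as a common bound for norms, parameters and `J` -/

theorem sum_le_B (z v : Vec d) :
    ‖z‖ ^ 2 + ‖v‖ ^ 2 + √(yNorm M) + max M.αT M.βT ≤ B M z v := by
  have h1 := hM.one_le_d
  have h2 : 0 ≤ max M.αT M.βT := le_max_of_le_left hM.αT_nonneg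
  have h3 : 0 ≤ 10 / 3 * ‖z‖ ^ 2 + 10 / 3 * ‖v‖ ^ 2 + √(yNorm M) := by positivity
  unfold B
  nlinarith [Real.sqrt_nonneg (yNorm M), sq_nonneg ‖z‖, sq_nonneg ‖v‖]

theorem norm_sq_left_le_B (z v : Vec d) : ‖z‖ ^ 2 ≤ B M z v := by
  have := hM.sum_le_B z v
  have : 0 ≤ max M.αT M.βT := le_max_of_le_left hM.αT_nonneg
  nlinarith [Real.sqrt_nonneg (yNorm M), sq_nonneg ‖v‖]

theorem norm_sq_right_le_B (z v : Vec d) : ‖v‖ ^ 2 ≤ B M z v := by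
  have := hM.sum_le_B z v
  have : 0 ≤ max M.αT M.βT := le_max_of_le_left hM.αT_nonneg
  nlinarith [Real.sqrt_nonneg (yNorm M), sq_nonneg ‖z‖]

theorem sqrt_yNorm_le_B (z v : Vec d) : √(yNorm M) ≤ B M z v := by
  have := hM.sum_le_B z v
  have : 0 ≤ max M.αT M.βT := le_max_of_le_left hM.αT_nonneg
  nlinarith [sq_nonneg ‖v‖, sq_nonneg ‖z‖]

theorem max_le_B (z v : Vec d) : max M.αT M.βT ≤ B M z v := by
  have := hM.sum_le_B z v
  nlinarith [Real.sqrt_nonneg (yNorm M), sq_nonneg ‖v‖, sq_nonneg ‖z‖]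

theorem B_nonneg (z v : Vec d) : 0 ≤ B M z v :=
  (Real.sqrt_nonneg _).trans (hM.sqrt_yNorm_le_B z v)

theorem exists_J_le_B : ∃ C : ℝ, 0 ≤ C ∧ ∀ z v, J M z v ≤ C * B M z v ^ 2 := by
  refine ⟨Fintype.card M.R * d ^ 3 + d + 2, by positivity, fun z v => ?_⟩
  have h0 := hM.B_nonneg z v
  have h1 : (‖z‖ * ‖v‖) ^ 2 ≤ B M z v ^ 2 := by
    rw [mul_pow, sq (B M z v)]
    gcongr
    · exact hM.norm_sq_left_le_B z v
    · exact hM.norm_sq_right_le_B z v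
  have h2 : yNorm M ≤ B M z v ^ 2 := by
    rw [← Real.sq_sqrt yNorm_nonneg]
    exact pow_le_pow_left₀ (Real.sqrt_nonneg _) (hM.sqrt_yNorm_le_B z v) 2
  have h3 : M.αT * ‖z‖ ^ 2 ≤ B M z v ^ 2 := by
    rw [sq (B M z v)]
    gcongr
    · exact (le_max_left _ _).trans (hM.max_le_B z v)
    · exact hM.norm_sq_left_le_B z v
  have h4 : M.βT * ‖v‖ ^ 2 ≤ B M z v ^ 2 := by
    rw [sq (B M z v)]
    gcongr
    · exact (le_max_right _ _).trans (hM.max_le_B z v)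
    · exact hM.norm_sq_right_le_B z v
  have h5 := hM.loss_le z v
  have h6 : Fintype.card M.R * (d : ℝ) ^ 3 * (‖z‖ * ‖v‖) ^ 2 ≤
    Fintype.card M.R * (d : ℝ) ^ 3 * B M z v ^ 2 := by gcongr
  have h7 : d * yNorm M ≤ d * B M z v ^ 2 := by gcongr
  unfold J
  linarith

theorem nonempty_R : Nonempty M.R := by
  by_contra h
  rw [not_nonempty_iff] at h
  have := hM.p_sum
  simp at this

theorem pMin_pos : 0 < pMin M := by
  have := hM.nonempty_R
  obtain ⟨r, hr⟩ := exists_eq_ciInf_of_finite (f := M.p)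
  unfold pMin
  rw [← hr]
  exact hM.p_pos r

/-- Division by `p_r` costs at most `1 / pMin` on the loss part `c`, while the regularization part
already carries the factor `p_r`, which cancels. -/
theorem norm_batch_le (s : Fin M.K → M.R) (g : M.R → Vec d) {c a : ℝ} (hc : 0 ≤ c)
    (hg : ∀ r, ‖g r‖ ≤ c + M.p r * a) :
    ‖((1 / (M.K : ℝ) : ℝ) : ℂ) • ∑ k, ((1 / M.p (s k) : ℝ) : ℂ) • g (s k)‖ ≤ c / pMin M + a := by
  have hK : (0 : ℝ) < M.K := by exact_mod_cast hM.K_pos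
  have h1 : ∀ k, ‖((1 / M.p (s k) : ℝ) : ℂ) • g (s k)‖ ≤ c / pMin M + a := by
    intro k
    have hp := hM.p_pos (s k)
    rw [norm_smul, Complex.norm_real, Real.norm_eq_abs, abs_of_pos (by positivity)]
    calc 1 / M.p (s k) * ‖g (s k)‖ ≤ 1 / M.p (s k) * (c + M.p (s k) * a) := by
          gcongr; exact hg _
      _ = c / M.p (s k) + a := by field_simp
      _ ≤ _ := by gcongr; exacts [hM.pMin_pos, pMin_le _]
  rw [norm_smul, Complex.norm_real, Real.norm_eq_abs, abs_of_pos (by positivity)]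
  calc 1 / (M.K : ℝ) * _ ≤ 1 / (M.K : ℝ) * ∑ _k : Fin M.K, (c / pMin M + a) := by
        gcongr; exact (norm_sum_le _ _).trans (Finset.sum_le_sum fun k _ => h1 k)
    _ = _ := by simp; field_simp

theorem norm_stochGradZ_le (s : Fin M.K → M.R) (z v : Vec d) :
    ‖stochGradZ M s z v‖ ≤ d ^ 2 * (‖v‖ * √(loss M z v)) / pMin M + M.αT * ‖z‖ := by
  have hα := hM.αT_nonneg
  refine hM.norm_batch_le s (fun r => gradZR M r z v) (by positivity) fun r => ?_
  refine (norm_add_le _ _).trans (add_le_add (hM.norm_gradZLossR_le r z v) (le_of_eq ?_))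
  have := hM.p_pos r
  rw [norm_smul, Complex.norm_real, Real.norm_eq_abs, abs_of_nonneg (by positivity)]
  ring

theorem norm_stochGradV_le (s : Fin M.K → M.R) (z v : Vec d) :
    ‖stochGradV M s z v‖ ≤ d ^ 2 * (‖z‖ * √(loss M z v)) / pMin M + M.βT * ‖v‖ := by
  have hβ := hM.βT_nonneg
  refine hM.norm_batch_le s (fun r => gradVR M r z v) (by positivity) fun r => ?_
  refine (norm_add_le _ _).trans (add_le_add (hM.norm_gradVLossR_le r z v) (le_of_eq ?_))
  have := hM.p_pos r
  rw [norm_smul, Complex.norm_real, Real.norm_eq_abs, abs_of_nonneg (by positivity)]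
  ring

theorem norm_gradZ_le (z v : Vec d) :
    ‖gradZ M z v‖ ≤ Fintype.card M.R * (d ^ 2 * (‖v‖ * √(loss M z v))) + M.αT * ‖z‖ := by
  refine (norm_add_le _ _).trans (add_le_add ?_ (le_of_eq ?_))
  · refine (norm_sum_le _ _).trans ((Finset.sum_le_sum fun r _ =>
      hM.norm_gradZLossR_le r z v).trans ?_)
    simp
  · rw [norm_smul, Complex.norm_real, Real.norm_eq_abs, abs_of_nonneg hM.αT_nonneg]

theorem norm_gradV_le (z v : Vec d) :
    ‖gradV M z v‖ ≤ Fintype.card M.R * (d ^ 2 * (‖z‖ * √(loss M z v))) + M.βT * ‖v‖ := by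
  refine (norm_add_le _ _).trans (add_le_add ?_ (le_of_eq ?_))
  · refine (norm_sum_le _ _).trans ((Finset.sum_le_sum fun r _ =>
      hM.norm_gradVLossR_le r z v).trans ?_)
    simp
  · rw [norm_smul, Complex.norm_real, Real.norm_eq_abs, abs_of_nonneg hM.βT_nonneg]

end Model.Admissible

end Ptycho

end
noncomputable section

namespace Ptycho

variable {d : ℕ} {M : Model d}

/-! ### One step of stochastic gradient descent -/

theorem real_inner_ofReal_smul_right (c : ℝ) (x y : Vec d) :
    inner ℝ x ((c : ℂ) • y) = c * inner ℝ x y := by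
  rw [real_inner_eq, real_inner_eq, ← Complex.re_ofReal_mul, Finset.mul_sum]
  simp only [PiLp.smul_apply, smul_eq_mul]
  congr 1
  exact Finset.sum_congr rfl fun j _ => by ring

theorem inner_stochGradZ (s : Fin M.K → M.R) (z v x : Vec d) :
    inner ℝ x (stochGradZ M s z v) =
      1 / (M.K : ℝ) * ∑ k, 1 / M.p (s k) * inner ℝ x (gradZR M (s k) z v) := by
  simp only [stochGradZ, real_inner_ofReal_smul_right, inner_sum]

theorem inner_stochGradV (s : Fin M.K → M.R) (z v x : Vec d) :
    inner ℝ x (stochGradV M s z v) =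
      1 / (M.K : ℝ) * ∑ k, 1 / M.p (s k) * inner ℝ x (gradVR M (s k) z v) := by
  simp only [stochGradV, real_inner_ofReal_smul_right, inner_sum]

theorem norm_grad_sq (z v : Vec d) :
    ‖grad M z v‖ ^ 2 = ‖gradZ M z v‖ ^ 2 + ‖gradV M z v‖ ^ 2 := by
  rw [WithLp.prod_norm_sq_eq_of_L2]
  rfl

theorem norm_sub_ofReal_smul_le (x g : Vec d) {μ : ℝ} (hμ : 0 ≤ μ) :
    ‖x - (μ : ℂ) • g‖ ≤ ‖x‖ + μ * ‖g‖ := by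
  refine (norm_sub_le _ _).trans_eq ?_
  rw [norm_smul, Complex.norm_real, Real.norm_of_nonneg hμ]

theorem norm_neg_ofReal_smul (g : Vec d) {μ : ℝ} (hμ : 0 ≤ μ) :
    ‖-((μ : ℂ) • g)‖ = μ * ‖g‖ := by
  rw [norm_neg, norm_smul, Complex.norm_real, Real.norm_of_nonneg hμ]

namespace Model.Admissible

variable (hM : M.Admissible)
include hM

theorem sum_gradZR (z v : Vec d) : ∑ r, gradZR M r z v = gradZ M z v := by
  simp only [gradZR, gradZ, Finset.sum_add_distrib, ← Finset.sum_smul, ← Complex.ofReal_sum,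
    ← Finset.mul_sum, hM.p_sum, mul_one]

theorem sum_gradVR (z v : Vec d) : ∑ r, gradVR M r z v = gradV M z v := by
  simp only [gradVR, gradV, Finset.sum_add_distrib, ← Finset.sum_smul, ← Complex.ofReal_sum,
    ← Finset.mul_sum, hM.p_sum, mul_one]

theorem norm_mul_sqrt_loss_le (z v : Vec d) :
    ‖v‖ * √(loss M z v) ≤ √(B M z v) * √(J M z v) ∧
      ‖z‖ * √(loss M z v) ≤ √(B M z v) * √(J M z v) := by
  have h := Real.sqrt_le_sqrt (hM.loss_le_J z v)
  exact ⟨mul_le_mul (Real.le_sqrt_of_sq_le (hM.norm_sq_right_le_B z v)) h (Real.sqrt_nonneg _)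
    (Real.sqrt_nonneg _), mul_le_mul (Real.le_sqrt_of_sq_le (hM.norm_sq_left_le_B z v)) h
    (Real.sqrt_nonneg _) (Real.sqrt_nonneg _)⟩

/-- Split `αT ‖z‖` as `√αT · √(αT ‖z‖²)`: the first factor is controlled by `B`, the second by `J`.
The factor `√J` is what makes the later errors proportional to `J`. -/
theorem αT_mul_norm_le (z v : Vec d) : M.αT * ‖z‖ ≤ √(B M z v) * √(J M z v) := by
  have h0 := hM.αT_nonneg
  rw [← Real.sqrt_mul (hM.B_nonneg z v)]
  apply Real.le_sqrt_of_sq_le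
  calc (M.αT * ‖z‖) ^ 2 = M.αT * (M.αT * ‖z‖ ^ 2) := by ring
    _ ≤ _ := mul_le_mul ((le_max_left _ _).trans (hM.max_le_B z v)) (hM.αT_mul_le_J z v)
      (by positivity) (hM.B_nonneg z v)

theorem βT_mul_norm_le (z v : Vec d) : M.βT * ‖v‖ ≤ √(B M z v) * √(J M z v) := by
  have h0 := hM.βT_nonneg
  rw [← Real.sqrt_mul (hM.B_nonneg z v)]
  apply Real.le_sqrt_of_sq_le
  calc (M.βT * ‖v‖) ^ 2 = M.βT * (M.βT * ‖v‖ ^ 2) := by ring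
    _ ≤ _ := mul_le_mul ((le_max_right _ _).trans (hM.max_le_B z v)) (hM.βT_mul_le_J z v)
      (by positivity) (hM.B_nonneg z v)

theorem exists_norm_grad_le : ∃ C : ℝ, 0 ≤ C ∧ ∀ z v,
    ‖gradZ M z v‖ ≤ C * (√(B M z v) * √(J M z v)) ∧
    ‖gradV M z v‖ ≤ C * (√(B M z v) * √(J M z v)) := by
  refine ⟨Fintype.card M.R * d ^ 2 + 1, by positivity, fun z v => ?_⟩
  obtain ⟨h1, h2⟩ := hM.norm_mul_sqrt_loss_le z v
  have h3 : (0 : ℝ) ≤ Fintype.card M.R * d ^ 2 := by positivity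
  constructor
  · refine (hM.norm_gradZ_le z v).trans ?_
    linarith [mul_le_mul_of_nonneg_left h1 h3, hM.αT_mul_norm_le z v]
  · refine (hM.norm_gradV_le z v).trans ?_
    linarith [mul_le_mul_of_nonneg_left h2 h3, hM.βT_mul_norm_le z v]

theorem exists_norm_stochGrad_le : ∃ C : ℝ, 0 ≤ C ∧ ∀ s z v,
    ‖stochGradZ M s z v‖ ≤ C * (√(B M z v) * √(J M z v)) ∧
    ‖stochGradV M s z v‖ ≤ C * (√(B M z v) * √(J M z v)) := by
  have hp := hM.pMin_pos
  refine ⟨d ^ 2 / pMin M + 1, by positivity, fun s z v => ?_⟩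
  obtain ⟨h1, h2⟩ := hM.norm_mul_sqrt_loss_le z v
  have h3 : (0 : ℝ) ≤ d ^ 2 / pMin M := by positivity
  constructor
  · refine (hM.norm_stochGradZ_le s z v).trans ?_
    rw [mul_div_right_comm]
    linarith [mul_le_mul_of_nonneg_left h1 h3, hM.αT_mul_norm_le z v]
  · refine (hM.norm_stochGradV_le s z v).trans ?_
    rw [mul_div_right_comm]
    linarith [mul_le_mul_of_nonneg_left h2 h3, hM.βT_mul_norm_le z v]

theorem exists_abs_inner_le : ∃ C : ℝ, 0 ≤ C ∧ ∀ s z v,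
    |inner ℝ (gradZ M z v) (stochGradZ M s z v)| ≤ C * (B M z v * J M z v) ∧
    |inner ℝ (gradV M z v) (stochGradV M s z v)| ≤ C * (B M z v * J M z v) := by
  obtain ⟨C₁, h1, hC₁⟩ := hM.exists_norm_grad_le
  obtain ⟨C₂, h2, hC₂⟩ := hM.exists_norm_stochGrad_le
  refine ⟨C₁ * C₂, by positivity, fun s z v => ?_⟩
  have key : C₁ * (√(B M z v) * √(J M z v)) * (C₂ * (√(B M z v) * √(J M z v))) =
      C₁ * C₂ * (B M z v * J M z v) := by
    calc _ = C₁ * C₂ * (√(B M z v) ^ 2 * √(J M z v) ^ 2) := by ring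
      _ = _ := by rw [Real.sq_sqrt (hM.B_nonneg z v), Real.sq_sqrt (hM.J_nonneg z v)]
  constructor
  · refine (abs_real_inner_le_norm _ _).trans (key ▸ ?_)
    exact mul_le_mul (hC₁ z v).1 (hC₂ s z v).1 (norm_nonneg _) (by positivity)
  · refine (abs_real_inner_le_norm _ _).trans (key ▸ ?_)
    exact mul_le_mul (hC₁ z v).2 (hC₂ s z v).2 (norm_nonneg _) (by positivity)

/-- Descent inequality for a step with step sizes at most `m`, up to an error of second order in
`m * B`. -/
theorem exists_J_step_le : ∃ C : ℝ, 0 ≤ C ∧ ∀ s z v, ∀ μ ν m : ℝ, 0 ≤ μ → 0 ≤ ν → μ ≤ m → ν ≤ m →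
    J M (z - (μ : ℂ) • stochGradZ M s z v) (v - (ν : ℂ) • stochGradV M s z v) ≤
      J M z v - 2 * μ * inner ℝ (gradZ M z v) (stochGradZ M s z v) -
        2 * ν * inner ℝ (gradV M z v) (stochGradV M s z v) +
        C * (((m * B M z v) ^ 2 + (m * B M z v) ^ 4) * J M z v) := by
  obtain ⟨C₁, h1, hC₁⟩ := hM.exists_norm_stochGrad_le
  obtain ⟨C₂, h2, hC₂⟩ := hM.exists_J_le_B
  -- A single constant that absorbs both `C₁` and `C₁² √C₂`.
  set c : ℝ := max C₁ 1 * max C₂ 1 with hc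
  have hc1 : C₁ ≤ c := (le_max_left _ 1).trans (le_mul_of_one_le_right
    (by positivity) (le_max_right _ _))
  have hc2 : C₁ ^ 2 * √C₂ ≤ c ^ 2 := by
    rw [hc, mul_pow]
    gcongr
    · exact le_max_left _ _
    · apply Real.sqrt_le_iff.2 ⟨by positivity, ?_⟩
      calc C₂ ≤ max C₂ 1 := le_max_left _ _
        _ ≤ _ := le_self_pow₀ (le_max_right _ _) (by norm_num)
        _ ≤ _ := le_self_pow₀ (one_le_pow₀ (le_max_right _ _)) (by norm_num)
  have hc0 : 0 ≤ c := by positivity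
  refine ⟨Fintype.card M.R * (2 * d ^ 2 * c ^ 2 + 2 * d ^ 3 * (2 * c) ^ 2 + 2 * d ^ 3 * c ^ 4) +
    2 * c ^ 2, by positivity, ?_⟩
  intro s z v μ ν m hμ hν hμm hνm
  have hm : 0 ≤ m := hμ.trans hμm
  have hB := hM.B_nonneg z v
  have hJ := hM.J_nonneg z v
  set b := B M z v
  set j := J M z v
  have hx : 0 ≤ m * b := by positivity
  have hbb : √b * √b = b := Real.mul_self_sqrt hB
  have hjj : √j * √j = j := Real.mul_self_sqrt hJ
  have ha : μ * ‖stochGradZ M s z v‖ ≤ C₁ * (m * √b * √j) := by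
    calc _ ≤ m * (C₁ * (√b * √j)) := mul_le_mul hμm (hC₁ s z v).1 (norm_nonneg _) hm
      _ = _ := by ring
  have hb : ν * ‖stochGradV M s z v‖ ≤ C₁ * (m * √b * √j) := by
    calc _ ≤ m * (C₁ * (√b * √j)) := mul_le_mul hνm (hC₁ s z v).2 (norm_nonneg _) hm
      _ = _ := by ring
  have hz : ‖z‖ ≤ √b := Real.le_sqrt_of_sq_le (hM.norm_sq_left_le_B z v)
  have hv : ‖v‖ ≤ √b := Real.le_sqrt_of_sq_le (hM.norm_sq_right_le_B z v)
  -- Trades one factor `√j` for `b`. In `a₁ * a₂`, which is of order `m² b j`, this leaves `(m b)²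
  -- √j`, so that multiplication by `√loss ≤ √j` restores exactly one factor `j`.
  have hjb : √j ≤ √C₂ * b := by
    rw [← Real.sqrt_sq hB, ← Real.sqrt_mul h2]
    exact Real.sqrt_le_sqrt (hC₂ z v)
  have step := hM.J_add_le z v (-((μ : ℂ) • stochGradZ M s z v)) (-((ν : ℂ) • stochGradV M s z v))
  rw [← sub_eq_add_neg, ← sub_eq_add_neg, inner_neg_right, inner_neg_right,
    real_inner_ofReal_smul_right, real_inner_ofReal_smul_right, norm_neg_ofReal_smul _ hμ,
    norm_neg_ofReal_smul _ hν] at step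
  set a₁ := μ * ‖stochGradZ M s z v‖
  set a₂ := ν * ‖stochGradV M s z v‖
  have ha0 : 0 ≤ a₁ := by positivity
  have hb0 : 0 ≤ a₂ := by positivity
  have hsq : (C₁ * (m * √b * √j)) ^ 2 = C₁ ^ 2 * (m * (m * b) * j) := by
    calc _ = C₁ ^ 2 * (m ^ 2 * (√b * √b) * (√j * √j)) := by ring
      _ = _ := by rw [hbb, hjj]; ring
  have hab : a₁ * a₂ ≤ c ^ 2 * ((m * b) ^ 2 * √j) := by
    calc a₁ * a₂ ≤ (C₁ * (m * √b * √j)) ^ 2 := by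
          rw [sq]; exact mul_le_mul ha hb hb0 (ha0.trans ha)
      _ = C₁ ^ 2 * (m * (m * b) * (√j * √j)) := by rw [hsq, hjj]
      _ ≤ C₁ ^ 2 * (m * (m * b) * (√j * (√C₂ * b))) := by gcongr
      _ = C₁ ^ 2 * √C₂ * ((m * b) ^ 2 * √j) := by ring
      _ ≤ _ := by gcongr
  have h3 : √(loss M z v) * (a₁ * a₂) ≤ c ^ 2 * ((m * b) ^ 2 * j) := by
    calc _ ≤ √j * (c ^ 2 * ((m * b) ^ 2 * √j)) :=
          mul_le_mul (Real.sqrt_le_sqrt (hM.loss_le_J z v)) hab (by positivity) (Real.sqrt_nonneg _)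
      _ = c ^ 2 * ((m * b) ^ 2 * (√j * √j)) := by ring
      _ = _ := by rw [hjj]
  have h4 : a₁ * ‖v‖ + ‖z‖ * a₂ + a₁ * a₂ ≤ (2 * c * (m * b) + c ^ 2 * (m * b) ^ 2) * √j := by
    have e1 : C₁ * (m * √b * √j) * √b ≤ c * ((m * b) * √j) := by
      calc _ = C₁ * (m * (√b * √b) * √j) := by ring
        _ = C₁ * ((m * b) * √j) := by rw [hbb]
        _ ≤ _ := by gcongr
    have e2 : a₁ * ‖v‖ ≤ C₁ * (m * √b * √j) * √b := by gcongr
    have e3 : ‖z‖ * a₂ ≤ √b * (C₁ * (m * √b * √j)) := by gcongr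
    linarith
  have h5 : (a₁ * ‖v‖ + ‖z‖ * a₂ + a₁ * a₂) ^ 2 ≤
      2 * ((2 * c) ^ 2 * (m * b) ^ 2 + c ^ 4 * (m * b) ^ 4) * j := by
    calc _ ≤ ((2 * c * (m * b) + c ^ 2 * (m * b) ^ 2) * √j) ^ 2 :=
          pow_le_pow_left₀ (by positivity) h4 2
      _ = (2 * c * (m * b) + c ^ 2 * (m * b) ^ 2) ^ 2 * (√j * √j) := by ring
      _ ≤ (2 * ((2 * c * (m * b)) ^ 2 + (c ^ 2 * (m * b) ^ 2) ^ 2)) * (√j * √j) := by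
          gcongr; exact add_sq_le
      _ = _ := by rw [hjj]; ring
  have hαb : M.αT ≤ b := (le_max_left _ _).trans (hM.max_le_B z v)
  have hβb : M.βT ≤ b := (le_max_right _ _).trans (hM.max_le_B z v)
  have hlast : b * (C₁ * (m * √b * √j)) ^ 2 ≤ c ^ 2 * ((m * b) ^ 2 * j) := by
    rw [hsq]
    calc _ = C₁ ^ 2 * ((m * b) ^ 2 * j) := by ring
      _ ≤ _ := by gcongr
  have h6 : M.αT * a₁ ^ 2 ≤ c ^ 2 * ((m * b) ^ 2 * j) := by
    refine le_trans ?_ hlast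
    gcongr
  have h7 : M.βT * a₂ ^ 2 ≤ c ^ 2 * ((m * b) ^ 2 * j) := by
    refine le_trans ?_ hlast
    gcongr
  have h8 : Fintype.card M.R * (2 * (d : ℝ) ^ 2 * (√(loss M z v) * (a₁ * a₂)) +
      (d : ℝ) ^ 3 * (a₁ * ‖v‖ + ‖z‖ * a₂ + a₁ * a₂) ^ 2) ≤
      Fintype.card M.R * (2 * (d : ℝ) ^ 2 * (c ^ 2 * ((m * b) ^ 2 * j)) +
      (d : ℝ) ^ 3 * (2 * ((2 * c) ^ 2 * (m * b) ^ 2 + c ^ 4 * (m * b) ^ 4) * j)) := by gcongr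
  have h9 : 0 ≤ (m * b) ^ 2 * j := by positivity
  have h10 : 0 ≤ (m * b) ^ 4 * j := by positivity
  -- The final constant multiplies both powers of `m * b`, whereas each estimate uses one of them;
  -- the surplus products are nonnegative.
  have h11 : (0 : ℝ) ≤ Fintype.card M.R * (2 * d ^ 2 * c ^ 2) * ((m * b) ^ 4 * j) := by positivity
  have h12 : (0 : ℝ) ≤ Fintype.card M.R * (2 * d ^ 3 * (2 * c) ^ 2) * ((m * b) ^ 4 * j) := by
    positivity
  have h13 : (0 : ℝ) ≤ Fintype.card M.R * (2 * d ^ 3 * c ^ 4) * ((m * b) ^ 2 * j) := by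
    positivity
  have h14 : (0 : ℝ) ≤ 2 * c ^ 2 * ((m * b) ^ 4 * j) := by positivity
  linarith

end Model.Admissible

/-! ### Consequences of the step size bounds -/

/-- For `b = 0` the hypothesis may be void, the power being `∞` when `q > 0`, but then the left side
vanishes. -/
theorem mul_le_of_ofReal_le_rpow {μ b q : ℝ} (hb : 0 ≤ b)
    (h : ENNReal.ofReal μ ≤ ENNReal.ofReal b ^ (-q)) : μ * b ≤ b ^ (1 - q) := by
  rcases hb.eq_or_lt with rfl | hb
  · rw [mul_zero]
    positivity
  · rw [ENNReal.ofReal_rpow_of_pos hb, ENNReal.ofReal_le_ofReal_iff (by positivity)] at h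
    calc μ * b ≤ b ^ (-q) * b := by gcongr
      _ = b ^ (1 - q) := by
        rw [sub_eq_neg_add, Real.rpow_add hb, Real.rpow_one]

/-- As `q ≥ 1`, the power `b ^ (1 - q)` is largest at the lower bound `b₀`. -/
theorem mul_le_of_ofReal_le_mul_rpow {μ b b₀ s q : ℝ} (hs : 0 ≤ s) (hb₀ : 0 < b₀)
    (hb : b₀ ≤ b) (hq : 1 ≤ q)
    (h : ENNReal.ofReal μ ≤ ENNReal.ofReal s * ENNReal.ofReal b ^ (-q)) :
    μ * b ≤ s * b₀ ^ (1 - q) := by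
  have hb' : 0 < b := hb₀.trans_le hb
  rw [ENNReal.ofReal_rpow_of_pos hb', ← ENNReal.ofReal_mul hs,
    ENNReal.ofReal_le_ofReal_iff (by positivity)] at h
  calc μ * b ≤ s * b ^ (-q) * b := by gcongr
    _ = s * b ^ (1 - q) := by
      rw [sub_eq_neg_add, Real.rpow_add hb', Real.rpow_one, mul_assoc]
    _ ≤ _ := by
      gcongr ?_ * ?_
      exact Real.rpow_le_rpow_of_nonpos hb₀ hb (by linarith)

namespace Model.Admissible

variable (hM : M.Admissible)
include hM

/-- Without data and regularization, a step from a point close to `0` ends close to `0`. -/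
theorem exists_J_step_le_of_B_lt (hα : M.αT = 0) (hβ : M.βT = 0) (hy : yNorm M = 0) {θ : ℝ}
    (hθ : θ < 1) (κ : ℝ) {η : ℝ} (hη : 0 < η) :
    ∃ b₀ : ℝ, 0 < b₀ ∧ ∀ t s z v, ∀ μ ν : ℝ, 0 ≤ μ → 0 ≤ ν → B M z v < b₀ →
      ENNReal.ofReal μ ≤ stepMax M θ κ t z v → ENNReal.ofReal ν ≤ stepMax M θ κ t z v →
      J M (z - (μ : ℂ) • stochGradZ M s z v) (v - (ν : ℂ) • stochGradV M s z v) ≤ η := by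
  have hp := hM.pMin_pos
  have hd : (0 : ℝ) < d := lt_of_lt_of_le one_pos hM.one_le_d
  have hK : (0 : ℝ) < M.K := by exact_mod_cast hM.K_pos
  set c : ℝ := Fintype.card M.R * d ^ 3
  have hc0 : 0 ≤ c := by positivity
  -- Without data and regularization, `Bz = A ‖v‖ (‖z‖ ‖v‖)`, and similarly for `Bv`; `D` is the
  -- ratio that bounds the stochastic gradients by `D * Bz` and `D * Bv`.
  set A : ℝ := √(15 / 4 * (d : ℝ)) * ((d : ℝ) / (√(M.K : ℝ) * pMin M)) with hA
  have hA0 : 0 < A := by positivity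
  set D : ℝ := d ^ 2 * √c / pMin M / A with hD
  have hD0 : 0 ≤ D := by positivity
  -- A step has length at most `D * Bz ^ q` or `D * Bv ^ q`; positivity of `q`, from `θ < 1`, makes
  -- it short near `0`.
  set q : ℝ := 1 - 2 / (3 - θ) with hq
  have hq0 : 0 < q := by
    rw [hq, sub_pos, div_lt_one (by linarith)]
    linarith
  have hJ : ∀ z v, J M z v ≤ c * (‖z‖ * ‖v‖) ^ 2 := by
    intro z v
    have := hM.loss_le z v
    rw [hy, mul_zero, add_zero] at this
    simpa only [J, hα, hβ, zero_mul, add_zero] using this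
  have hloss : ∀ z v, √(loss M z v) ≤ √c * (‖z‖ * ‖v‖) := by
    intro z v
    rw [← Real.sqrt_sq (by positivity : 0 ≤ ‖z‖ * ‖v‖), ← Real.sqrt_mul hc0]
    exact Real.sqrt_le_sqrt ((hM.loss_le_J z v).trans (hJ z v))
  -- Bounds `J` after a step that starts at norms at most `δ`; it is continuous and vanishes at `0`.
  set f : ℝ → ℝ := fun δ => c * ((δ + D * (A * δ) ^ q) * (δ + D * (A * δ) ^ q)) ^ 2 with hf
  have hfc : Continuous f := by
    have : Continuous fun δ : ℝ => (A * δ) ^ q :=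
      Continuous.rpow_const (by fun_prop) fun _ => Or.inr hq0.le
    fun_prop
  have hf0 : f 0 = 0 := by simp [hf, Real.zero_rpow hq0.ne']
  have hev : ∀ᶠ δ in 𝓝[>] (0 : ℝ), f δ < η ∧ δ < 1 :=
    nhdsWithin_le_nhds (((hfc.tendsto 0).eventually_lt_const (by rwa [hf0])).and
      (eventually_lt_nhds one_pos))
  obtain ⟨δ, ⟨hδη, hδ1⟩, hδ0⟩ := (hev.and self_mem_nhdsWithin).exists
  have hδ0' : (0 : ℝ) < δ := hδ0
  refine ⟨δ ^ 2, by positivity, fun t s z v μ ν hμ hν hB hμm hνm => ?_⟩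
  have hz : ‖z‖ ≤ δ := (pow_le_pow_iff_left₀ (norm_nonneg _) hδ0'.le two_ne_zero).1
    ((hM.norm_sq_left_le_B z v).trans hB.le)
  have hv : ‖v‖ ≤ δ := (pow_le_pow_iff_left₀ (norm_nonneg _) hδ0'.le two_ne_zero).1
    ((hM.norm_sq_right_le_B z v).trans hB.le)
  have h3 : ∀ a b e : ℝ, 0 ≤ a → 0 ≤ b → 0 ≤ e → a ≤ δ → b ≤ δ → e ≤ δ → a * (b * e) ≤ δ := by
    intro a b e ha hb he ha' hb' he'
    calc a * (b * e) ≤ δ * (1 * 1) := by gcongr <;> linarith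
      _ = δ := by ring
  have hμB : ENNReal.ofReal μ ≤ ENNReal.ofReal (Bz M z v) ^ (-(2 / (3 - θ))) :=
    hμm.trans ((min_le_right _ _).trans (min_le_left _ _))
  have hνB : ENNReal.ofReal ν ≤ ENNReal.ofReal (Bv M z v) ^ (-(2 / (3 - θ))) :=
    hνm.trans ((min_le_right _ _).trans ((min_le_right _ _).trans (min_le_left _ _)))
  have hBz : Bz M z v = A * (‖v‖ * (‖z‖ * ‖v‖)) := by
    simp only [Bz, hy, hα, Real.sqrt_zero, zero_mul, add_zero, hA]
    ring
  have hBv : Bv M z v = A * (‖z‖ * (‖z‖ * ‖v‖)) := by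
    simp only [Bv, hy, hβ, Real.sqrt_zero, zero_mul, add_zero, hA]
    ring
  have hstep : ∀ (τ g b x : ℝ), 0 ≤ τ → 0 ≤ x → x ≤ δ → g ≤ D * b → b = A * x →
      ENNReal.ofReal τ ≤ ENNReal.ofReal b ^ (-(2 / (3 - θ))) → τ * g ≤ D * (A * δ) ^ q := by
    intro τ g b x hτ hx hxδ hg hb h
    have hb0 : 0 ≤ b := by rw [hb]; positivity
    calc τ * g ≤ τ * (D * b) := by gcongr
      _ = D * (τ * b) := by ring
      _ ≤ D * b ^ q := by gcongr; exact mul_le_of_ofReal_le_rpow hb0 h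
      _ ≤ _ := by rw [hb]; gcongr
  have hDA : ∀ x : ℝ, D * (A * x) = d ^ 2 * √c / pMin M * x := by
    intro x
    rw [hD, ← mul_assoc, div_mul_cancel₀ _ hA0.ne']
  have hgz : ‖stochGradZ M s z v‖ ≤ D * Bz M z v := by
    refine (hM.norm_stochGradZ_le s z v).trans ?_
    rw [hα, zero_mul, add_zero, hBz, hDA]
    calc _ ≤ d ^ 2 * (‖v‖ * (√c * (‖z‖ * ‖v‖))) / pMin M := by gcongr; exact hloss z v
      _ = _ := by ring
  have hgv : ‖stochGradV M s z v‖ ≤ D * Bv M z v := by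
    refine (hM.norm_stochGradV_le s z v).trans ?_
    rw [hβ, zero_mul, add_zero, hBv, hDA]
    calc _ ≤ d ^ 2 * (‖z‖ * (√c * (‖z‖ * ‖v‖))) / pMin M := by gcongr; exact hloss z v
      _ = _ := by ring
  have h1 : ‖z - (μ : ℂ) • stochGradZ M s z v‖ ≤ δ + D * (A * δ) ^ q :=
    (norm_sub_ofReal_smul_le _ _ hμ).trans (add_le_add hz (hstep _ _ _ _ hμ (by positivity)
      (h3 _ _ _ (norm_nonneg _) (norm_nonneg _) (norm_nonneg _) hv hz hv) hgz hBz hμB))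
  have h2 : ‖v - (ν : ℂ) • stochGradV M s z v‖ ≤ δ + D * (A * δ) ^ q :=
    (norm_sub_ofReal_smul_le _ _ hν).trans (add_le_add hv (hstep _ _ _ _ hν (by positivity)
      (h3 _ _ _ (norm_nonneg _) (norm_nonneg _) (norm_nonneg _) hz hz hv) hgv hBv hνB))
  refine (hJ _ _).trans (le_trans ?_ hδη.le)
  simp only [hf]
  gcongr

end Model.Admissible

end Ptycho

end
noncomputable section

namespace Ptycho

/-! ### Convergence of almost supermartingales -/

section RobbinsSiegmund

variable {Ω : Type*} {m₀ : MeasurableSpace Ω} {P : Measure Ω}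

theorem exists_tendsto_prod_one_add {c : ℕ → ℝ} (hc : ∀ t, 0 ≤ c t) (hcs : Summable c) :
    ∃ l : ℝ, (∀ t, ∏ s ∈ Finset.range t, (1 + c s) ≤ l) ∧
      Tendsto (fun t => ∏ s ∈ Finset.range t, (1 + c s)) atTop (𝓝 l) := by
  have hmono : Monotone fun t => ∏ s ∈ Finset.range t, (1 + c s) := by
    refine monotone_nat_of_le_succ fun t => ?_
    rw [Finset.prod_range_succ]
    exact le_mul_of_one_le_right (Finset.prod_nonneg fun s _ => by linarith [hc s])
      (by linarith [hc t])
  have hbdd : BddAbove (Set.range fun t => ∏ s ∈ Finset.range t, (1 + c s)) := by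
    refine ⟨Real.exp (∑' s, c s), ?_⟩
    rintro _ ⟨t, rfl⟩
    calc ∏ s ∈ Finset.range t, (1 + c s) ≤ ∏ s ∈ Finset.range t, Real.exp (c s) := by
          refine Finset.prod_le_prod (fun s _ => by linarith [hc s]) fun s _ => ?_
          linarith [Real.add_one_le_exp (c s)]
      _ = Real.exp (∑ s ∈ Finset.range t, c s) := (Real.exp_sum _ _).symm
      _ ≤ _ := Real.exp_le_exp.2 (hcs.sum_le_tsum _ fun s _ => hc s)
  exact ⟨_, fun t => le_ciSup hbdd t, tendsto_atTop_ciSup hmono hbdd⟩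

/-- The Robbins–Siegmund theorem, with deterministic coefficients. -/
theorem ae_tendsto_and_summable_of_condExp_le [IsProbabilityMeasure P] {ℱ : Filtration ℕ m₀}
    {V D : ℕ → Ω → ℝ} {c e : ℕ → ℝ} (hV : StronglyAdapted ℱ V) (hD : StronglyAdapted ℱ D)
    (hVi : ∀ t, Integrable (V t) P) (hDi : ∀ t, Integrable (D t) P)
    (hV0 : ∀ t ω, 0 ≤ V t ω) (hD0 : ∀ t ω, 0 ≤ D t ω) (hc : ∀ t, 0 ≤ c t) (he : ∀ t, 0 ≤ e t)
    (hcs : Summable c) (hes : Summable e)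
    (h : ∀ t, P[V (t + 1)|ℱ t] ≤ᵐ[P] fun ω => (1 + c t) * V t ω + e t - D t ω) :
    ∀ᵐ ω ∂P, (∃ l, Tendsto (fun t => V t ω) atTop (𝓝 l)) ∧ Summable fun t => D t ω := by
  obtain ⟨L, hL, hQ⟩ := exists_tendsto_prod_one_add hc hcs
  set Q : ℕ → ℝ := fun t => ∏ s ∈ Finset.range t, (1 + c s)
  have hQ1 : ∀ t, 1 ≤ Q t := fun t => by
    simpa using Finset.prod_le_prod (s := Finset.range t) (f := fun _ => (1 : ℝ))
      (fun _ _ => zero_le_one) fun s _ => by linarith [hc s]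
  have hQ0 : ∀ t, 0 < Q t := fun t => one_pos.trans_le (hQ1 t)
  have hQs : ∀ t, Q (t + 1) = Q t * (1 + c t) := fun t => Finset.prod_range_succ _ _
  set S : ℕ → Ω → ℝ := fun t => ∑ s ∈ Finset.range t, (Q (s + 1))⁻¹ • (D s - fun _ => e s) with hS
  -- Dividing by `Q` removes the factor `1 + c t`, and the sum `S` compensates the terms `e` and
  -- `D`, so `W` is a supermartingale. It is bounded below by `-E`.
  set W : ℕ → Ω → ℝ := fun t => (Q t)⁻¹ • V t + S t with hW
  set E : ℝ := ∑' s, e s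
  have hSi : ∀ t, Integrable (S t) P := fun t =>
    integrable_finsetSum' _ fun s _ => ((hDi s).sub (integrable_const _)).smul _
  have hWi : ∀ t, Integrable (W t) P := fun t => ((hVi t).smul _).add (hSi t)
  have hSm : ∀ t, StronglyMeasurable[ℱ t] (S (t + 1)) := fun t =>
    Finset.stronglyMeasurable_sum _ fun s hs =>
      (((hD s).mono (ℱ.mono (Nat.lt_succ_iff.1 (Finset.mem_range.1 hs)))).sub
        stronglyMeasurable_const).const_smul _
  have hSm' : ∀ t, StronglyMeasurable[ℱ t] (S t) := fun t =>
    Finset.stronglyMeasurable_sum _ fun s hs =>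
      (((hD s).mono (ℱ.mono (Finset.mem_range.1 hs).le)).sub
        stronglyMeasurable_const).const_smul _
  have hWm : StronglyAdapted ℱ W := fun t => ((hV t).const_smul _).add (hSm' t)
  have hsuper : Supermartingale W ℱ P := by
    refine supermartingale_nat hWm hWi fun t => ?_
    have h1 : P[W (t + 1)|ℱ t] =ᵐ[P] P[(Q (t + 1))⁻¹ • V (t + 1)|ℱ t] + P[S (t + 1)|ℱ t] :=
      condExp_add ((hVi _).smul _) (hSi _) _
    have h2 : P[(Q (t + 1))⁻¹ • V (t + 1)|ℱ t] =ᵐ[P] (Q (t + 1))⁻¹ • P[V (t + 1)|ℱ t] :=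
      condExp_smul _ _ _
    have h3 : P[S (t + 1)|ℱ t] = S (t + 1) :=
      condExp_of_stronglyMeasurable (ℱ.le t) (hSm t) (hSi _)
    rw [h3] at h1
    filter_upwards [h1, h2, h t] with ω h1 h2 h4
    rw [h1, Pi.add_apply, h2]
    simp only [hW, hS, Pi.add_apply, Pi.smul_apply, Finset.sum_apply, Finset.sum_range_succ,
      smul_eq_mul, Pi.sub_apply]
    have h5 := mul_le_mul_of_nonneg_left h4 (inv_nonneg.2 (hQ0 (t + 1)).le)
    have h6 : (Q (t + 1))⁻¹ * ((1 + c t) * V t ω) = (Q t)⁻¹ * V t ω := by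
      have : (1 + c t) ≠ 0 := by linarith [hc t]
      rw [hQs, mul_inv]
      field_simp
    rw [mul_sub, mul_add, h6] at h5
    rw [mul_sub]
    linarith
  have hSe : ∀ t ω, S t ω = ∑ s ∈ Finset.range t, (Q (s + 1))⁻¹ * D s ω -
      ∑ s ∈ Finset.range t, (Q (s + 1))⁻¹ * e s := by
    intro t ω
    simp only [hS, Finset.sum_apply, Pi.smul_apply, Pi.sub_apply, smul_eq_mul, mul_sub,
      Finset.sum_sub_distrib]
  have heQ0 : ∀ s, 0 ≤ (Q (s + 1))⁻¹ * e s := fun s =>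
    mul_nonneg (inv_nonneg.2 (hQ0 _).le) (he s)
  have heQ : ∀ s, (Q (s + 1))⁻¹ * e s ≤ e s := fun s =>
    mul_le_of_le_one_left (he s) (inv_le_one_of_one_le₀ (hQ1 _))
  have heQs : Summable fun s => (Q (s + 1))⁻¹ * e s := Summable.of_nonneg_of_le heQ0 heQ hes
  have heE : ∀ t, ∑ s ∈ Finset.range t, (Q (s + 1))⁻¹ * e s ≤ E := fun t =>
    (Finset.sum_le_sum fun s _ => heQ s).trans (hes.sum_le_tsum _ fun s _ => he s)
  have hV' : ∀ t ω, 0 ≤ (Q t)⁻¹ * V t ω := fun t ω =>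
    mul_nonneg (inv_nonneg.2 (hQ0 t).le) (hV0 t ω)
  have hD' : ∀ s ω, 0 ≤ (Q (s + 1))⁻¹ * D s ω := fun s ω =>
    mul_nonneg (inv_nonneg.2 (hQ0 _).le) (hD0 s ω)
  have hWe : ∀ t ω, W t ω = (Q t)⁻¹ * V t ω + (∑ s ∈ Finset.range t, (Q (s + 1))⁻¹ * D s ω -
      ∑ s ∈ Finset.range t, (Q (s + 1))⁻¹ * e s) := by
    intro t ω
    rw [← hSe]
    rfl
  have hWlow : ∀ t ω, -E ≤ W t ω := by
    intro t ω
    rw [hWe]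
    linarith [hV' t ω, Finset.sum_nonneg fun s (_ : s ∈ Finset.range t) => hD' s ω, heE t]
  -- Then `C₀ - W t` has nonnegative mean and is at most `C₀ + E`, which together bound its `L¹`
  -- norm.
  set C₀ : ℝ := ∫ ω, W 0 ω ∂P
  have hsub : Submartingale (fun t => (fun _ => C₀) - W t) ℱ P :=
    (martingale_const ℱ P C₀).submartingale.sub_supermartingale hsuper
  have hbound : ∀ t, eLpNorm ((fun _ => C₀) - W t) 1 P ≤ ((2 * (C₀ + E).toNNReal : NNReal) : ℝ≥0∞) := by
    intro t
    have := eLpNorm_one_le_of_le' (μ := P) (f := (fun _ => C₀) - W t) (r := C₀ + E)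
      ((integrable_const _).sub (hWi t)) ?_ ?_
    · simpa [ENNReal.ofReal] using this
    · have h1 := hsuper.setIntegral_le (Nat.zero_le t) MeasurableSet.univ
      rw [setIntegral_univ, setIntegral_univ] at h1
      have h2 : ∫ ω, ((fun _ : Ω => C₀) - W t) ω ∂P = C₀ - ∫ ω, W t ω ∂P := by
        simp only [Pi.sub_apply]
        rw [integral_sub (integrable_const _) (hWi t)]
        simp
      rw [h2]
      linarith
    · refine Eventually.of_forall fun ω => ?_
      simp only [Pi.sub_apply]
      linarith [hWlow t ω]
  filter_upwards [hsub.exists_ae_tendsto_of_bdd hbound] with ω ⟨l, hl⟩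
  have hWt : Tendsto (fun t => W t ω) atTop (𝓝 (C₀ - l)) := by
    have := (tendsto_const_nhds (x := C₀)).sub hl
    simpa using this
  obtain ⟨b, hb⟩ := hWt.bddAbove_range
  have hDs : Summable fun s => (Q (s + 1))⁻¹ * D s ω := by
    refine summable_of_sum_range_le (c := b + E) (fun s => hD' s ω) fun t => ?_
    have := hb ⟨t, rfl⟩
    simp only [hWe] at this
    linarith [hV' t ω, heE t]
  constructor
  · have h1 : Tendsto (fun t => W t ω - ∑ s ∈ Finset.range t, (Q (s + 1))⁻¹ * D s ω +
        ∑ s ∈ Finset.range t, (Q (s + 1))⁻¹ * e s) atTop _ :=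
      (hWt.sub hDs.hasSum.tendsto_sum_nat).add heQs.hasSum.tendsto_sum_nat
    refine ⟨_, (hQ.mul h1).congr fun t => ?_⟩
    rw [hWe]
    have := (hQ0 t).ne'
    field_simp
    ring
  · refine Summable.of_nonneg_of_le (fun s => hD0 s ω) (fun s => ?_) (hDs.mul_left L)
    rw [← mul_assoc]
    refine le_mul_of_one_le_left (hD0 s ω) ?_
    rw [← div_eq_mul_inv, one_le_div (hQ0 _)]
    exact hL _

end RobbinsSiegmund

/-! ### Functions of the past samples -/

section Past

variable {d : ℕ} {M : Model d} {Ω : Type*} {r : ℕ → Fin M.K → Ω → M.R}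

/-- `f` is a function of the samples `r^{s,k}` with `s < t`. -/
def DependsOnPast {E : Type*} (r : ℕ → Fin M.K → Ω → M.R) (t : ℕ) (f : Ω → E) : Prop :=
  ∀ ω ω', (∀ s < t, ∀ k, r s k ω = r s k ω') → f ω = f ω'

namespace DependsOnPast

variable {E F G : Type*} {t : ℕ}

theorem const (x : E) : DependsOnPast r t fun _ => x := fun _ _ _ => rfl

theorem mono {f : Ω → E} {t' : ℕ} (hf : DependsOnPast r t f) (h : t ≤ t') :
    DependsOnPast r t' f :=
  fun ω ω' hω => hf ω ω' fun s hs k => hω s (hs.trans_le h) k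

theorem comp {f : Ω → E} (hf : DependsOnPast r t f) (g : E → F) :
    DependsOnPast r t fun ω => g (f ω) :=
  fun ω ω' h => congrArg g (hf ω ω' h)

theorem comp₂ {f : Ω → E} {f' : Ω → F} (hf : DependsOnPast r t f) (hf' : DependsOnPast r t f')
    (g : E → F → G) : DependsOnPast r t fun ω => g (f ω) (f' ω) :=
  fun ω ω' h => congrArg₂ g (hf ω ω' h) (hf' ω ω' h)

theorem sample : DependsOnPast r (t + 1) fun ω k => r t k ω :=
  fun _ _ h => funext fun k => h t t.lt_succ_self k

theorem measurable_past : Measurable[pastAlgebra M r t]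
    fun ω (s : Fin t) (k : Fin M.K) => r s k ω := by
  refine @measurable_pi_lambda _ _ _ (pastAlgebra M r t) _ _ fun s => ?_
  refine @measurable_pi_lambda _ _ _ (pastAlgebra M r t) _ _ fun k => ?_
  intro S _
  exact (le_iSup₂_of_le (f := fun (s : Fin t) (k : Fin M.K) => MeasurableSpace.comap (r s k) ⊤)
    s k le_rfl) _ ⟨S, trivial, rfl⟩

/-- The sample history takes values in a finite space in which every set is measurable, so any
function factoring through it is measurable, whatever its formula. -/
theorem measurable [MeasurableSpace E] {f : Ω → E} (hf : DependsOnPast r t f) :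
    Measurable[pastAlgebra M r t] f := by
  intro S _
  have : f ⁻¹' S = (fun ω (s : Fin t) (k : Fin M.K) => r s k ω) ⁻¹'
      ((fun ω (s : Fin t) (k : Fin M.K) => r s k ω) '' (f ⁻¹' S)) := by
    refine Set.Subset.antisymm (Set.subset_preimage_image _ _) ?_
    rintro ω ⟨ω', h1, h2⟩
    rw [Set.mem_preimage, hf ω ω' fun s hs k => (congrFun (congrFun h2 ⟨s, hs⟩) k).symm]
    exact h1
  rw [this]
  exact measurable_past (Set.toFinite _).measurableSet

/-- The past σ-algebra is contained in the one pulled back along the sample history, so level sets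
of `f` are unions of fibres of the history. This converts adapted step sizes into functions of the
samples. -/
theorem of_measurable {f : Ω → ℝ} (hf : Measurable[pastAlgebra M r t] f) :
    DependsOnPast r t f := by
  intro ω ω' h
  have hle : pastAlgebra M r t ≤
      MeasurableSpace.comap (fun ω (s : Fin t) (k : Fin M.K) => r s k ω) ⊤ := by
    refine iSup₂_le fun s k => ?_
    rintro _ ⟨S, -, rfl⟩
    exact ⟨{x | x s k ∈ S}, trivial, rfl⟩
  obtain ⟨S, -, hS⟩ := hle _ (hf (measurableSet_singleton (f ω')))
  have h1 : ω' ∈ f ⁻¹' {f ω'} := rfl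
  rw [← hS] at h1
  have h2 : ω ∈ f ⁻¹' {f ω'} := by
    rw [← hS]
    have : (fun (s : Fin t) (k : Fin M.K) => r s k ω) = fun (s : Fin t) k => r s k ω' :=
      funext fun s => funext fun k => h s s.2 k
    rw [Set.mem_preimage, this]
    exact h1
  exact h2

theorem finite_range {f : Ω → E} (hf : DependsOnPast r t f) : (Set.range f).Finite := by
  rcases isEmpty_or_nonempty Ω with h | ⟨⟨ω₀⟩⟩
  · simp [Set.range_eq_empty]
  have hfac : Function.FactorsThrough f fun ω (s : Fin t) (k : Fin M.K) => r s k ω :=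
    fun ω ω' h => hf ω ω' fun s hs k => congrFun (congrFun h ⟨s, hs⟩) k
  refine (Set.finite_range (Function.extend (fun ω (s : Fin t) (k : Fin M.K) => r s k ω) f
    fun _ => f ω₀)).subset ?_
  rintro _ ⟨ω, rfl⟩
  exact ⟨_, hfac.extend_apply _ ω⟩

end DependsOnPast

variable [MeasurableSpace Ω] {P : Measure Ω}

namespace IsSampling

variable (hr : IsSampling M P r)
include hr

theorem pastAlgebra_le (t : ℕ) : pastAlgebra M r t ≤ ‹MeasurableSpace Ω› := by
  refine iSup₂_le fun s k => ?_
  rintro _ ⟨S, -, rfl⟩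
  exact hr.measurable s k (Set.toFinite S).measurableSet

/-- The filtration generated by the samples. -/
def filtration : Filtration ℕ ‹MeasurableSpace Ω› where
  seq := pastAlgebra M r
  mono' _ _ hst := iSup_le fun u => le_iSup_of_le (Fin.castLE hst u) le_rfl
  le' := hr.pastAlgebra_le

theorem measurable_of_dependsOnPast {E : Type*} [MeasurableSpace E] {t : ℕ} {f : Ω → E}
    (hf : DependsOnPast r t f) : Measurable f := hf.measurable.mono (hr.pastAlgebra_le t) le_rfl

theorem integrable [IsFiniteMeasure P] {t : ℕ} {f : Ω → ℝ} (hf : DependsOnPast r t f) :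
    Integrable f P := by
  obtain ⟨C, hC⟩ := (hf.comp fun x => ‖x‖).finite_range.bddAbove
  exact Integrable.of_bound (hr.measurable_of_dependsOnPast hf).aestronglyMeasurable C
    (Eventually.of_forall fun ω => hC ⟨ω, rfl⟩)

theorem indep_past (t : ℕ) (k : Fin M.K) :
    Indep (MeasurableSpace.comap (r t k) inferInstance) (pastAlgebra M r t) P := by
  set m : ℕ × Fin M.K → MeasurableSpace Ω := fun i =>
    MeasurableSpace.comap (r i.1 i.2) inferInstance with hm
  have h : Indep (⨆ i ∈ ({(t, k)} : Set (ℕ × Fin M.K)), m i)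
      (⨆ i ∈ {i : ℕ × Fin M.K | i.1 < t}, m i) P :=
    indep_iSup_of_disjoint (m := m) (fun i => (hr.measurable i.1 i.2).comap_le)
      hr.indep.iIndep (by simp)
  refine indep_of_indep_of_le_left (indep_of_indep_of_le_right h ?_) ?_
  · refine iSup₂_le fun s k => ?_
    have h1 : m ((s : ℕ), k) ≤ ⨆ i ∈ {i : ℕ × Fin M.K | i.1 < t}, m i := le_biSup m s.2
    -- `pastAlgebra` uses `⊤` on the sample space and independence uses its inherited σ-algebra; on
    -- a finite set they agree.
    exact (MeasurableSpace.comap_mono fun S _ => (Set.toFinite S).measurableSet).trans h1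
  · exact le_biSup m (Set.mem_singleton (t, k))

/-- Decompose by the value of the sample: the coefficient `f ρ` is known from the past and is pulled
out, and the indicator of `ρ` is independent of the past with mean `p_ρ`. -/
theorem condExp_sample [IsProbabilityMeasure P] (hp : ∀ ρ, 0 < M.p ρ) {t : ℕ} (k : Fin M.K)
    {f : M.R → Ω → ℝ} (hf : ∀ ρ, DependsOnPast r t (f ρ)) :
    P[fun ω => f (r t k ω) ω|pastAlgebra M r t] =ᵐ[P] fun ω => ∑ ρ, M.p ρ * f ρ ω := by
  classical
  set χ : M.R → Ω → ℝ := fun ρ => (r t k ⁻¹' {ρ}).indicator fun _ => 1 with hχ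
  have hsum : (fun ω => f (r t k ω) ω) = ∑ ρ, f ρ * χ ρ := by
    ext ω
    simp only [Finset.sum_apply, Pi.mul_apply, hχ]
    rw [Finset.sum_eq_single (r t k ω)]
    · simp
    · intro ρ _ hρ
      rw [Set.indicator_of_notMem, mul_zero]
      exact fun h => hρ h.symm
    · simp
  have hset : ∀ ρ, MeasurableSet (r t k ⁻¹' {ρ}) := fun ρ =>
    hr.measurable t k (measurableSet_singleton ρ)
  have hχi : ∀ ρ, Integrable (χ ρ) P := fun ρ => (integrable_const 1).indicator (hset ρ)
  have hχp : ∀ ρ, DependsOnPast r (t + 1) (χ ρ) := fun ρ =>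
    DependsOnPast.sample.comp fun s : Fin M.K → M.R => ({ρ} : Set M.R).indicator (fun _ => 1) (s k)
  have hfχ : ∀ ρ, Integrable (f ρ * χ ρ) P := fun ρ =>
    hr.integrable (((hf ρ).mono t.le_succ).comp₂ (hχp ρ) fun a b => a * b)
  have h1 : ∀ ρ, P[f ρ * χ ρ|pastAlgebra M r t] =ᵐ[P] fun ω => M.p ρ * f ρ ω := by
    intro ρ
    have h2 := condExp_mul_of_stronglyMeasurable_left (hf ρ).measurable.stronglyMeasurable (hfχ ρ)
      (hχi ρ)
    have h3 : P[χ ρ|pastAlgebra M r t] =ᵐ[P] fun _ => P[χ ρ] := by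
      refine condExp_indep_eq (hr.measurable t k).comap_le (hr.pastAlgebra_le t) ?_
        (hr.indep_past t k)
      exact stronglyMeasurable_const.indicator ⟨{ρ}, measurableSet_singleton ρ, rfl⟩
    have h4 : P[χ ρ] = M.p ρ := by
      rw [hχ, integral_indicator (hset ρ)]
      have := hr.law t k ρ
      simp only [integral_const, smul_eq_mul, mul_one, MeasurableSet.univ, measureReal_def,
        Measure.restrict_apply, Set.univ_inter]
      change (P {ω | r t k ω = ρ}).toReal = _
      rw [this, ENNReal.toReal_ofReal (hp ρ).le]
    filter_upwards [h2, h3] with ω h2 h3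
    rw [h2, Pi.mul_apply, h3, h4, mul_comm]
  rw [hsum]
  refine (condExp_finsetSum (fun ρ _ => hfχ ρ) _).trans ?_
  filter_upwards [ae_all_iff.2 h1] with ω h1
  simp only [Finset.sum_apply, h1]

end IsSampling

end Past

end Ptycho

end
noncomputable section

namespace Ptycho

variable {d : ℕ} {M : Model d}

/-! ### Step sizes -/

/-- The factor `(1 + t)^{-1 + κ}` in the bound for the step sizes. -/
def decay (κ : ℝ) (t : ℕ) : ℝ := (1 + (t : ℝ)) ^ (-1 + κ)

theorem decay_pos (κ : ℝ) (t : ℕ) : 0 < decay κ t := by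
  unfold decay
  positivity

theorem decay_le_one {κ : ℝ} (hκ : κ ≤ 1) (t : ℕ) : decay κ t ≤ 1 :=
  Real.rpow_le_one_of_one_le_of_nonpos (by linarith [(Nat.cast_nonneg t : (0 : ℝ) ≤ t)])
    (by linarith)

theorem summable_decay_sq {κ : ℝ} (hκ : κ < 1 / 2) : Summable fun t => decay κ t ^ 2 := by
  have h := (summable_nat_add_iff 1).2 (Real.summable_nat_rpow.2
    (by linarith : (-1 + κ) * 2 < -1))
  refine h.congr fun t => ?_
  rw [decay, ← Real.rpow_natCast, ← Real.rpow_mul (by positivity)]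
  push_cast
  rw [add_comm]

theorem mul_B_le_of_le_stepMax {θ κ b₀ μ : ℝ} {t : ℕ} {z v : Vec d} (hθ₀ : 0 ≤ θ) (hθ₁ : θ < 1)
    (hb₀ : 0 < b₀) (hb : b₀ ≤ B M z v) (hμ : ENNReal.ofReal μ ≤ stepMax M θ κ t z v) :
    μ * B M z v ≤ decay κ t * b₀ ^ (1 - 1 / (1 - θ)) := by
  refine mul_le_of_ofReal_le_mul_rpow (decay_pos κ t).le hb₀ hb ?_ (hμ.trans (min_le_left _ _))
  rw [le_div_iff₀ (by linarith)]
  linarith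

/-- The change of `J` in one step, to first order. -/
def linearChange (s : Fin M.K → M.R) (z v : Vec d) (μ ν : ℝ) : ℝ :=
  -(2 * μ * inner ℝ (gradZ M z v) (stochGradZ M s z v)) -
    2 * ν * inner ℝ (gradV M z v) (stochGradV M s z v)

/-- The squared positive part of `x - η`. -/
def excess (η x : ℝ) : ℝ := max (x - η) 0 ^ 2

/-- The squared positive part is `C¹` with 2-Lipschitz derivative. The square is taken for this
reason: the positive part itself has a kink, and no first-order term with a usable conditional mean.
-/
theorem excess_add_le (η x u : ℝ) :
    excess η (x + u) ≤ excess η x + 2 * max (x - η) 0 * u + u ^ 2 := by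
  unfold excess
  rcases le_total (x - η) 0 with h | h <;> rcases le_total (x + u - η) 0 with h' | h'
  · rw [max_eq_right h, max_eq_right h']
    nlinarith [sq_nonneg u]
  · rw [max_eq_right h, max_eq_left h']
    nlinarith
  · rw [max_eq_left h, max_eq_right h']
    nlinarith [sq_nonneg (x - η + u)]
  · rw [max_eq_left h, max_eq_left h']
    nlinarith

theorem excess_mono (η : ℝ) {x y : ℝ} (h : x ≤ y) : excess η x ≤ excess η y := by
  unfold excess
  gcongr

theorem excess_nonneg (η x : ℝ) : 0 ≤ excess η x := sq_nonneg _

/-- Lets errors proportional to `J²` be absorbed into a multiple of the excess and a constant, as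
Robbins–Siegmund requires. -/
theorem sq_le_excess {η x : ℝ} (hx : 0 ≤ x) :
    x ^ 2 ≤ 2 * excess η x + 2 * η ^ 2 := by
  have h : x ≤ max (x - η) 0 + η := by linarith [le_max_left (x - η) 0]
  unfold excess
  nlinarith [sq_nonneg (max (x - η) 0 - η), pow_le_pow_left₀ hx h 2]

/-- The root of the excess is the positive part of `a - η`, which differs from `a ≥ 0` by at most
`η`; as `η` is arbitrarily small, `a` is Cauchy. -/
theorem exists_tendsto_of_excess {a : ℕ → ℝ} (ha : ∀ t, 0 ≤ a t)
    (h : ∀ n : ℕ, ∃ l, Tendsto (fun t => excess (1 / ((n : ℝ) + 1)) (a t)) atTop (𝓝 l)) :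
    ∃ l, Tendsto a atTop (𝓝 l) := by
  apply cauchySeq_tendsto_of_complete
  rw [Metric.cauchySeq_iff]
  intro δ hδ
  obtain ⟨n, hn⟩ := exists_nat_one_div_lt (half_pos hδ)
  set η : ℝ := 1 / ((n : ℝ) + 1)
  have hη : 0 ≤ η := by positivity
  obtain ⟨l, hl⟩ := h n
  have h1 : Tendsto (fun t => max (a t - η) 0) atTop (𝓝 √l) :=
    hl.sqrt.congr fun t => by rw [excess, Real.sqrt_sq (le_max_right _ _)]
  obtain ⟨N, hN⟩ := Metric.cauchySeq_iff.1 h1.cauchySeq (δ / 2) (half_pos hδ)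
  refine ⟨N, fun m hm k hk => ?_⟩
  have h2 := hN m hm k hk
  rw [Real.dist_eq, abs_lt] at h2 ⊢
  have h3 : ∀ t, a t - η ≤ max (a t - η) 0 ∧ max (a t - η) 0 ≤ a t := fun t =>
    ⟨le_max_left _ _, max_le (by linarith) (ha t)⟩
  constructor <;> linarith [h3 m, h3 k, (h3 m).1, (h3 m).2, (h3 k).1, (h3 k).2]

namespace Model.Admissible

variable (hM : M.Admissible)
include hM

theorem exists_abs_linearChange_le : ∃ C : ℝ, 0 ≤ C ∧ ∀ s z v, ∀ μ ν m : ℝ, 0 ≤ μ → 0 ≤ ν →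
    μ ≤ m → ν ≤ m → |linearChange (M := M) s z v μ ν| ≤ C * ((m * B M z v) * J M z v) := by
  obtain ⟨C, h0, hC⟩ := hM.exists_abs_inner_le
  refine ⟨4 * C, by positivity, fun s z v μ ν m hμ hν hμm hνm => ?_⟩
  have hB := hM.B_nonneg z v
  have hJ := hM.J_nonneg z v
  have key : ∀ τ i : ℝ, 0 ≤ τ → τ ≤ m → |i| ≤ C * (B M z v * J M z v) →
      |2 * τ * i| ≤ 2 * C * ((m * B M z v) * J M z v) := by
    intro τ i h1 h2 h3
    rw [abs_mul, abs_of_nonneg (by positivity)]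
    have hm : 0 ≤ m := h1.trans h2
    calc 2 * τ * |i| ≤ 2 * m * (C * (B M z v * J M z v)) := by gcongr
      _ = _ := by ring
  have h1 := abs_le.1 (key μ _ hμ hμm (hC s z v).1)
  have h2 := abs_le.1 (key ν _ hν hνm (hC s z v).2)
  rw [linearChange, abs_le]
  constructor <;> linarith

theorem exists_J_step_le_decay {θ κ b₀ : ℝ} (hθ₀ : 0 ≤ θ) (hθ₁ : θ < 1) (hκ : κ ≤ 1)
    (hb₀ : 0 < b₀) :
    ∃ C : ℝ, 0 ≤ C ∧ ∀ t s z v, ∀ μ ν : ℝ, 0 ≤ μ → 0 ≤ ν → b₀ ≤ B M z v →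
      ENNReal.ofReal μ ≤ stepMax M θ κ t z v → ENNReal.ofReal ν ≤ stepMax M θ κ t z v →
      |linearChange (M := M) s z v μ ν| ≤ C * decay κ t * J M z v ∧
      J M (z - (μ : ℂ) • stochGradZ M s z v) (v - (ν : ℂ) • stochGradV M s z v) ≤
        J M z v + linearChange s z v μ ν + C * decay κ t ^ 2 * J M z v := by
  obtain ⟨C₁, h1, hC₁⟩ := hM.exists_J_step_le
  obtain ⟨C₂, h2, hC₂⟩ := hM.exists_abs_linearChange_le
  set X : ℝ := b₀ ^ (1 - 1 / (1 - θ))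
  have hX : 0 ≤ X := by positivity
  refine ⟨max (C₂ * X) (C₁ * (X ^ 2 + X ^ 4)), by positivity,
    fun t s z v μ ν hμ hν hB hμm hνm => ?_⟩
  have hJ := hM.J_nonneg z v
  have hB0 := hM.B_nonneg z v
  have hs := decay_pos κ t
  have hs1 := decay_le_one hκ t
  have hx : max μ ν * B M z v ≤ decay κ t * X := by
    rcases max_choice μ ν with h | h <;> rw [h]
    · exact mul_B_le_of_le_stepMax hθ₀ hθ₁ hb₀ hB hμm
    · exact mul_B_le_of_le_stepMax hθ₀ hθ₁ hb₀ hB hνm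
  have hx0 : 0 ≤ max μ ν * B M z v := mul_nonneg (hμ.trans (le_max_left _ _)) hB0
  constructor
  · refine (hC₂ s z v μ ν _ hμ hν (le_max_left _ _) (le_max_right _ _)).trans ?_
    calc _ ≤ C₂ * ((decay κ t * X) * J M z v) := by gcongr
      _ = (C₂ * X) * decay κ t * J M z v := by ring
      _ ≤ _ := by gcongr; exact le_max_left _ _
  · have h := hC₁ s z v μ ν _ hμ hν (le_max_left _ _) (le_max_right _ _)
    have h3 : C₁ * (((max μ ν * B M z v) ^ 2 + (max μ ν * B M z v) ^ 4) * J M z v) ≤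
        max (C₂ * X) (C₁ * (X ^ 2 + X ^ 4)) * decay κ t ^ 2 * J M z v := by
      calc _ ≤ C₁ * (((decay κ t * X) ^ 2 + (decay κ t * X) ^ 4) * J M z v) := by gcongr
        _ = C₁ * ((decay κ t ^ 2 * X ^ 2 + decay κ t ^ 4 * X ^ 4) * J M z v) := by ring
        _ ≤ C₁ * ((decay κ t ^ 2 * X ^ 2 + decay κ t ^ 2 * X ^ 4) * J M z v) := by
          have : decay κ t ^ 4 ≤ decay κ t ^ 2 := pow_le_pow_of_le_one hs.le hs1 (by norm_num)
          gcongr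
        _ = C₁ * (X ^ 2 + X ^ 4) * decay κ t ^ 2 * J M z v := by ring
        _ ≤ _ := by gcongr; exact le_max_right _ _
    rw [linearChange]
    linarith

theorem exists_excess_step_le {θ κ b₀ : ℝ} (hθ₀ : 0 ≤ θ) (hθ₁ : θ < 1) (hκ : κ ≤ 1)
    (hb₀ : 0 < b₀) (η : ℝ) :
    ∃ C : ℝ, 0 ≤ C ∧ ∀ t s z v, ∀ μ ν : ℝ, 0 ≤ μ → 0 ≤ ν → b₀ ≤ B M z v →
      ENNReal.ofReal μ ≤ stepMax M θ κ t z v → ENNReal.ofReal ν ≤ stepMax M θ κ t z v →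
      excess η (J M (z - (μ : ℂ) • stochGradZ M s z v) (v - (ν : ℂ) • stochGradV M s z v)) ≤
        (1 + C * decay κ t ^ 2) * excess η (J M z v) + C * decay κ t ^ 2 +
          2 * max (J M z v - η) 0 * linearChange s z v μ ν := by
  obtain ⟨C, h0, hC⟩ := hM.exists_J_step_le_decay hθ₀ hθ₁ hκ hb₀
  refine ⟨max ((2 * C + 4 * C ^ 2 + 2 * |η| * C) * 2)
      ((2 * C + 4 * C ^ 2 + 2 * |η| * C) * (2 * η ^ 2)), by positivity,
    fun t s z v μ ν hμ hν hB hμm hνm => ?_⟩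
  -- `2 * C` pays for the second-order error times the positive part, `4 * C ^ 2` for the squared
  -- increment; the last term is slack.
  set A := 2 * C + 4 * C ^ 2 + 2 * |η| * C with hA
  have hA0 : 0 ≤ A := by positivity
  have hJ := hM.J_nonneg z v
  have hs := decay_pos κ t
  have hs1 := decay_le_one hκ t
  obtain ⟨h1, h2⟩ := hC t s z v μ ν hμ hν hB hμm hνm
  set j := J M z v
  set l := linearChange (M := M) s z v μ ν
  set σ := decay κ t
  refine (excess_mono η h2).trans ?_
  rw [add_assoc]
  refine (excess_add_le η j _).trans ?_
  have h3 : (l + C * σ ^ 2 * j) ^ 2 ≤ 4 * C ^ 2 * (σ ^ 2 * j ^ 2) := by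
    have hle : |l + C * σ ^ 2 * j| ≤ 2 * C * σ * j := by
      refine (abs_add_le _ _).trans ?_
      have : C * σ ^ 2 * j ≤ C * σ * j := by
        gcongr
        exact pow_le_of_le_one hs.le hs1 two_ne_zero
      rw [abs_of_nonneg (by positivity : 0 ≤ C * σ ^ 2 * j)]
      linarith
    rw [← sq_abs]
    calc _ ≤ (2 * C * σ * j) ^ 2 := pow_le_pow_left₀ (abs_nonneg _) hle 2
      _ = _ := by ring
  have hj : j ^ 2 ≤ 2 * excess η j + 2 * η ^ 2 := sq_le_excess hJ
  have h4 : 2 * max (j - η) 0 * (C * σ ^ 2 * j) ≤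
      2 * C * (σ ^ 2 * (2 * excess η j + 2 * η ^ 2)) := by
    have h5 : max (j - η) 0 * j ≤ 2 * excess η j + 2 * η ^ 2 := by
      have : max (j - η) 0 ^ 2 = excess η j := rfl
      have := two_mul_le_add_sq (max (j - η) 0) j
      nlinarith [sq_nonneg η, excess_nonneg η j]
    calc _ = 2 * C * (σ ^ 2 * (max (j - η) 0 * j)) := by ring
      _ ≤ _ := by gcongr
  have h6 : 4 * C ^ 2 * (σ ^ 2 * j ^ 2) ≤ 4 * C ^ 2 * (σ ^ 2 * (2 * excess η j + 2 * η ^ 2)) := by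
    gcongr
  have he := excess_nonneg η j
  have h7 : (2 * C + 4 * C ^ 2) * (σ ^ 2 * (2 * excess η j + 2 * η ^ 2)) ≤
      A * 2 * (σ ^ 2 * excess η j) + A * (2 * η ^ 2) * σ ^ 2 := by
    have : 2 * C + 4 * C ^ 2 ≤ A := by
      rw [hA]
      have : 0 ≤ 2 * |η| * C := by positivity
      linarith
    calc _ ≤ A * (σ ^ 2 * (2 * excess η j + 2 * η ^ 2)) := by gcongr
      _ = _ := by ring
  have h8 : A * 2 * (σ ^ 2 * excess η j) ≤
      max (A * 2) (A * (2 * η ^ 2)) * (σ ^ 2 * excess η j) := by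
    gcongr
    exact le_max_left _ _
  have h9 : A * (2 * η ^ 2) * σ ^ 2 ≤ max (A * 2) (A * (2 * η ^ 2)) * σ ^ 2 := by
    gcongr
    exact le_max_right _ _
  linarith

/-- If `B` is small in a point, then one step from this point ends at a small value of `J`. -/
theorem exists_B_threshold {θ : ℝ} (hθ : θ < 1) (κ : ℝ) {η : ℝ} (hη : 0 < η) :
    ∃ b₀ : ℝ, 0 < b₀ ∧ ∀ t s z v, ∀ μ ν : ℝ, 0 ≤ μ → 0 ≤ ν → B M z v < b₀ →
      ENNReal.ofReal μ ≤ stepMax M θ κ t z v → ENNReal.ofReal ν ≤ stepMax M θ κ t z v →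
      J M (z - (μ : ℂ) • stochGradZ M s z v) (v - (ν : ℂ) • stochGradV M s z v) ≤ η := by
  have h0 : 0 ≤ max M.αT M.βT := le_max_of_le_left hM.αT_nonneg
  rcases h0.eq_or_lt with h | h
  · rcases (yNorm_nonneg (M := M)).eq_or_lt with hy | hy
    · refine hM.exists_J_step_le_of_B_lt ?_ ?_ hy.symm hθ κ hη
      · exact le_antisymm (h.symm ▸ le_max_left _ _) hM.αT_nonneg
      · exact le_antisymm (h.symm ▸ le_max_right _ _) hM.βT_nonneg
    · exact ⟨√(yNorm M), Real.sqrt_pos.2 hy, fun t s z v μ ν _ _ hB =>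
        absurd (hM.sqrt_yNorm_le_B z v) (not_le.2 hB)⟩
  · exact ⟨_, h, fun t s z v μ ν _ _ hB => absurd (hM.max_le_B z v) (not_le.2 hB)⟩

end Model.Admissible

/-! ### Almost sure convergence -/

section Iteration

variable {Ω : Type*} {r : ℕ → Fin M.K → Ω → M.R} {μ ν : ℕ → Ω → ℝ} {z₀ v₀ : Vec d}
  {z v : ℕ → Ω → Vec d}

/-- The hypothesis on the step sizes may use the iterates of the same time, which covers both
prescribed adapted step sizes and those computed from `stepMax`. -/
theorem IsSGD.dependsOnPast (hsgd : IsSGD M r μ ν z₀ v₀ z v)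
    (h : ∀ t, DependsOnPast r t (z t) → DependsOnPast r t (v t) →
      DependsOnPast r t (μ t) ∧ DependsOnPast r t (ν t)) (t : ℕ) :
    DependsOnPast r t (z t) ∧ DependsOnPast r t (v t) := by
  induction t with
  | zero =>
    exact ⟨fun ω ω' _ => by rw [hsgd.z_zero, hsgd.z_zero],
      fun ω ω' _ => by rw [hsgd.v_zero, hsgd.v_zero]⟩
  | succ t ih =>
    obtain ⟨hz, hv⟩ := ih
    obtain ⟨hμ, hν⟩ := h t hz hv
    constructor
    · intro ω ω' hω
      have h1 : (fun k => r t k ω) = fun k => r t k ω' := DependsOnPast.sample ω ω' hω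
      rw [hsgd.z_succ, hsgd.z_succ, h1, (hz.mono t.le_succ) ω ω' hω, (hv.mono t.le_succ) ω ω' hω,
        (hμ.mono t.le_succ) ω ω' hω]
    · intro ω ω' hω
      have h1 : (fun k => r t k ω) = fun k => r t k ω' := DependsOnPast.sample ω ω' hω
      rw [hsgd.v_succ, hsgd.v_succ, h1, (hz.mono t.le_succ) ω ω' hω, (hv.mono t.le_succ) ω ω' hω,
        (hν.mono t.le_succ) ω ω' hω]

variable [MeasurableSpace Ω] {P : Measure Ω} [IsProbabilityMeasure P]

/-- The linear change is a sum over the batch of functions of one sample each, so only independence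
of each sample from the past matters. The importance weights `1 / p_r` make the mean gradient the
full one. The weight `w` is `1` when the lemma is applied to `J` and the derivative of the excess
when it is applied to the truncated loss. -/
theorem IsSampling.condExp_le_of_le_linearChange (hM : M.Admissible) (hr : IsSampling M P r)
    {t : ℕ} {z v : Ω → Vec d} {μ ν w A V : Ω → ℝ} (hz : DependsOnPast r t z)
    (hv : DependsOnPast r t v) (hμ : DependsOnPast r t μ) (hν : DependsOnPast r t ν)
    (hw : DependsOnPast r t w) (hA : DependsOnPast r t A) (hV : DependsOnPast r (t + 1) V)
    (h : ∀ ω, V ω ≤ A ω +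
      w ω * linearChange (fun k => r t k ω) (z ω) (v ω) (μ ω) (ν ω)) :
    P[V|pastAlgebra M r t] ≤ᵐ[P] fun ω => A ω -
      w ω * (2 * μ ω * ‖gradZ M (z ω) (v ω)‖ ^ 2 + 2 * ν ω * ‖gradV M (z ω) (v ω)‖ ^ 2) := by
  have hK : (M.K : ℝ) ≠ 0 := by exact_mod_cast hM.K_pos.ne'
  set f : M.R → Ω → ℝ := fun ρ ω => w ω *
    (-(2 * μ ω * (1 / (M.K : ℝ) * (1 / M.p ρ *
      inner ℝ (gradZ M (z ω) (v ω)) (gradZR M ρ (z ω) (v ω))))) -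
    2 * ν ω * (1 / (M.K : ℝ) * (1 / M.p ρ *
      inner ℝ (gradV M (z ω) (v ω)) (gradVR M ρ (z ω) (v ω))))) with hf
  have hfd : ∀ ρ, DependsOnPast r t (f ρ) := by
    intro ρ ω ω' hω
    simp only [hf, hw ω ω' hω, hμ ω ω' hω, hν ω ω' hω, hz ω ω' hω, hv ω ω' hω]
  have hU : ∀ ω, w ω * linearChange (fun k => r t k ω) (z ω) (v ω) (μ ω) (ν ω) =
      ∑ k, f (r t k ω) ω := by
    intro ω
    simp only [linearChange, inner_stochGradZ, inner_stochGradV, hf, ← Finset.mul_sum,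
      Finset.sum_sub_distrib, Finset.sum_neg_distrib]
  have hsum : ∀ ω, ∑ ρ, M.p ρ * f ρ ω = 1 / (M.K : ℝ) * (-(w ω *
      (2 * μ ω * ‖gradZ M (z ω) (v ω)‖ ^ 2 + 2 * ν ω * ‖gradV M (z ω) (v ω)‖ ^ 2))) := by
    intro ω
    rw [← real_inner_self_eq_norm_sq (gradZ M (z ω) (v ω)),
      ← real_inner_self_eq_norm_sq (gradV M (z ω) (v ω))]
    conv_rhs => rw [← hM.sum_gradZR (z ω) (v ω), ← hM.sum_gradVR (z ω) (v ω)]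
    rw [inner_sum (𝕜 := ℝ) Finset.univ, inner_sum (𝕜 := ℝ) Finset.univ, Finset.mul_sum,
      Finset.mul_sum, ← Finset.sum_add_distrib, Finset.mul_sum, ← Finset.sum_neg_distrib,
      Finset.mul_sum]
    refine Finset.sum_congr rfl fun ρ _ => ?_
    rw [hM.sum_gradZR, hM.sum_gradVR, hf]
    have := (hM.p_pos ρ).ne'
    field_simp
    ring
  have hfi : ∀ k, Integrable (fun ω => f (r t k ω) ω) P := by
    intro k
    refine hr.integrable (t := t + 1) fun ω ω' hω => ?_
    rw [hω t t.lt_succ_self k]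
    exact (hfd _).mono t.le_succ ω ω' hω
  have hAi : Integrable A P := hr.integrable hA
  have h1 : P[V|pastAlgebra M r t] ≤ᵐ[P]
      P[A + ∑ k, fun ω => f (r t k ω) ω|pastAlgebra M r t] := by
    refine condExp_mono (hr.integrable hV) (hAi.add (integrable_finsetSum' _ fun k _ => hfi k))
      (Eventually.of_forall fun ω => ?_)
    simpa only [Pi.add_apply, Finset.sum_apply, ← hU] using h ω
  have h2 : P[A + ∑ k, fun ω => f (r t k ω) ω|pastAlgebra M r t] =ᵐ[P]
      P[A|pastAlgebra M r t] + P[∑ k, fun ω => f (r t k ω) ω|pastAlgebra M r t] :=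
    condExp_add hAi (integrable_finsetSum' _ fun k _ => hfi k) _
  have h3 : P[A|pastAlgebra M r t] = A :=
    condExp_of_stronglyMeasurable (hr.pastAlgebra_le t) hA.measurable.stronglyMeasurable hAi
  have h4 : P[∑ k, fun ω => f (r t k ω) ω|pastAlgebra M r t] =ᵐ[P]
      ∑ k, P[fun ω => f (r t k ω) ω|pastAlgebra M r t] :=
    condExp_finsetSum (fun k _ => hfi k) _
  have h5 := ae_all_iff.2 fun k => hr.condExp_sample hM.p_pos k hfd
  rw [h3] at h2
  filter_upwards [h1, h2, h4, h5] with ω h1 h2 h4 h5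
  rw [h2, Pi.add_apply, h4, Finset.sum_apply] at h1
  simp only [h5, hsum, Finset.sum_const, Finset.card_univ, Fintype.card_fin, nsmul_eq_mul] at h1
  refine h1.trans (le_of_eq ?_)
  field_simp
  ring

variable {θ κ : ℝ}

/-- If `B` is bounded away from `0`, then `J` converges, and the squared gradients, weighted with
the step sizes, are summable. -/
theorem IsSGD.ae_tendsto_J_and_summable (hM : M.Admissible) (hr : IsSampling M P r)
    (hsgd : IsSGD M r μ ν z₀ v₀ z v) (hθ₀ : 0 ≤ θ) (hθ₁ : θ < 1) (hκ : κ < 1 / 2)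
    {b₀ : ℝ} (hb₀ : 0 < b₀) (hB : ∀ z v, b₀ ≤ B M z v)
    (hd : ∀ t, DependsOnPast r t (z t) ∧ DependsOnPast r t (v t))
    (hμd : ∀ t, DependsOnPast r t (μ t)) (hνd : ∀ t, DependsOnPast r t (ν t))
    (hμ : ∀ t ω, 0 ≤ μ t ω) (hν : ∀ t ω, 0 ≤ ν t ω)
    (hμm : ∀ t ω, ENNReal.ofReal (μ t ω) ≤ stepMax M θ κ t (z t ω) (v t ω))
    (hνm : ∀ t ω, ENNReal.ofReal (ν t ω) ≤ stepMax M θ κ t (z t ω) (v t ω)) :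
    ∀ᵐ ω ∂P, (∃ l, Tendsto (fun t => J M (z t ω) (v t ω)) atTop (𝓝 l)) ∧
      Summable fun t => 2 * μ t ω * ‖gradZ M (z t ω) (v t ω)‖ ^ 2 +
        2 * ν t ω * ‖gradV M (z t ω) (v t ω)‖ ^ 2 := by
  obtain ⟨C, h0, hC⟩ := hM.exists_J_step_le_decay hθ₀ hθ₁ (by linarith : κ ≤ 1) hb₀
  have hVd : ∀ t, DependsOnPast r t fun ω => J M (z t ω) (v t ω) := fun t =>
    (hd t).1.comp₂ (hd t).2 (J M)
  have hDd : ∀ t, DependsOnPast r t fun ω => 2 * μ t ω * ‖gradZ M (z t ω) (v t ω)‖ ^ 2 +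
        2 * ν t ω * ‖gradV M (z t ω) (v t ω)‖ ^ 2 := by
    intro t ω ω' hω
    simp only [hμd t ω ω' hω, hνd t ω ω' hω, (hd t).1 ω ω' hω, (hd t).2 ω ω' hω]
  refine ae_tendsto_and_summable_of_condExp_le (ℱ := hr.filtration)
    (c := fun t => C * decay κ t ^ 2) (e := fun _ => 0)
    (fun t => (hVd t).measurable.stronglyMeasurable)
    (fun t => (hDd t).measurable.stronglyMeasurable)
    (fun t => hr.integrable (hVd t)) (fun t => hr.integrable (hDd t))
    (fun t ω => hM.J_nonneg _ _) (fun t ω => ?_) (fun t => by positivity) (fun t => le_rfl)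
    ((summable_decay_sq hκ).mul_left C) summable_zero fun t => ?_
  · have := hμ t ω
    have := hν t ω
    positivity
  · have h := hr.condExp_le_of_le_linearChange hM (w := fun _ => 1)
      (A := fun ω => (1 + C * decay κ t ^ 2) * J M (z t ω) (v t ω)) (hd t).1 (hd t).2
      (hμd t) (hνd t) (DependsOnPast.const 1) ((hVd t).comp _) (hVd (t + 1)) fun ω => ?_
    · filter_upwards [h] with ω h
      refine h.trans (le_of_eq ?_)
      ring
    · rw [hsgd.z_succ, hsgd.v_succ]
      have := (hC t (fun k => r t k ω) _ _ _ _ (hμ t ω) (hν t ω) (hB _ _) (hμm t ω) (hνm t ω)).2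
      linarith

/-- No lower bound for `B` is available here, so the supermartingale argument is run for each
truncation level. Below the threshold for `B` the next excess is `0`; above it the one-step
inequality holds. -/
theorem IsSGD.ae_tendsto_J (hM : M.Admissible) (hr : IsSampling M P r)
    (hsgd : IsSGD M r μ ν z₀ v₀ z v) (hθ₀ : 0 ≤ θ) (hθ₁ : θ < 1) (hκ : κ < 1 / 2)
    (hμd : ∀ t, DependsOnPast r t (μ t)) (hνd : ∀ t, DependsOnPast r t (ν t))
    (hμ : ∀ t ω, 0 ≤ μ t ω) (hν : ∀ t ω, 0 ≤ ν t ω)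
    (hμm : ∀ t ω, ENNReal.ofReal (μ t ω) ≤ stepMax M θ κ t (z t ω) (v t ω))
    (hνm : ∀ t ω, ENNReal.ofReal (ν t ω) ≤ stepMax M θ κ t (z t ω) (v t ω)) :
    ∀ᵐ ω ∂P, ∃ l, Tendsto (fun t => J M (z t ω) (v t ω)) atTop (𝓝 l) := by
  classical
  have hd := hsgd.dependsOnPast fun t _ _ => ⟨hμd t, hνd t⟩
  have key : ∀ n : ℕ, ∀ᵐ ω ∂P, ∃ l,
      Tendsto (fun t => excess (1 / ((n : ℝ) + 1)) (J M (z t ω) (v t ω))) atTop (𝓝 l) := by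
    intro n
    set η : ℝ := 1 / ((n : ℝ) + 1)
    have hη : 0 < η := by positivity
    obtain ⟨b₀, hb₀, hsmall⟩ := hM.exists_B_threshold hθ₁ κ hη
    obtain ⟨C, h0, hC⟩ := hM.exists_excess_step_le hθ₀ hθ₁ (by linarith : κ ≤ 1) hb₀ η
    have hVd : ∀ t, DependsOnPast r t fun ω => excess η (J M (z t ω) (v t ω)) := fun t =>
      (hd t).1.comp₂ (hd t).2 fun z v => excess η (J M z v)
    have hc : Summable fun t => C * decay κ t ^ 2 := (summable_decay_sq hκ).mul_left C
    -- Only convergence is needed, so the nonpositive drift is dropped by taking `D = 0`.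
    refine (ae_tendsto_and_summable_of_condExp_le (ℱ := hr.filtration) (D := fun _ _ => 0)
      (c := fun t => C * decay κ t ^ 2) (e := fun t => C * decay κ t ^ 2)
      (fun t => (hVd t).measurable.stronglyMeasurable)
      (fun t => stronglyMeasurable_const)
      (fun t => hr.integrable (hVd t)) (fun t => integrable_const _)
      (fun t ω => excess_nonneg _ _) (fun t ω => le_rfl) (fun t => by positivity)
      (fun t => by positivity) hc hc fun t => ?_).mono fun ω h => h.1
    have h := hr.condExp_le_of_le_linearChange hM
      -- The weight is switched off on the set, known at time `t`, where the expansion is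
      -- unavailable and the next excess vanishes anyway.
      (w := fun ω => if B M (z t ω) (v t ω) < b₀ then 0 else 2 * max (J M (z t ω) (v t ω) - η) 0)
      (A := fun ω => (1 + C * decay κ t ^ 2) * excess η (J M (z t ω) (v t ω)) +
        C * decay κ t ^ 2) (hd t).1 (hd t).2 (hμd t) (hνd t)
      ((hd t).1.comp₂ (hd t).2 fun z v => if B M z v < b₀ then 0 else 2 * max (J M z v - η) 0)
      ((hVd t).comp fun x => (1 + C * decay κ t ^ 2) * x + C * decay κ t ^ 2)
      (hVd (t + 1)) fun ω => ?_
    · filter_upwards [h] with ω h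
      refine h.trans ?_
      have := hμ t ω
      have := hν t ω
      have : 0 ≤ if B M (z t ω) (v t ω) < b₀ then 0 else 2 * max (J M (z t ω) (v t ω) - η) 0 := by
        split_ifs <;> positivity
      have := mul_nonneg this (by positivity : 0 ≤ 2 * μ t ω * ‖gradZ M (z t ω) (v t ω)‖ ^ 2 +
        2 * ν t ω * ‖gradV M (z t ω) (v t ω)‖ ^ 2)
      linarith
    · rw [hsgd.z_succ, hsgd.v_succ]
      by_cases hB : B M (z t ω) (v t ω) < b₀
      · have := hsmall t (fun k => r t k ω) _ _ _ _ (hμ t ω) (hν t ω) hB (hμm t ω) (hνm t ω)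
        have h1 := excess_nonneg η (J M (z t ω) (v t ω))
        have h2 : excess η (J M (z t ω - (μ t ω : ℂ) • stochGradZ M (fun k => r t k ω) (z t ω)
            (v t ω)) (v t ω - (ν t ω : ℂ) • stochGradV M (fun k => r t k ω) (z t ω) (v t ω))) = 0 := by
          rw [excess, max_eq_right (by linarith), zero_pow two_ne_zero]
        rw [if_pos hB, zero_mul, add_zero, h2]
        positivity
      · rw [if_neg hB]
        exact hC t (fun k => r t k ω) _ _ _ _ (hμ t ω) (hν t ω) (not_lt.1 hB) (hμm t ω) (hνm t ω)
  filter_upwards [ae_all_iff.2 key] with ω h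
  exact exists_tendsto_of_excess (fun t => hM.J_nonneg _ _) h

end Iteration

end Ptycho

end
noncomputable section

namespace Ptycho

variable {d : ℕ} {M : Model d}

/-! ### Divergence of the step size sums -/

/-- A lower bound for `∑_{t < T} (1 + t)^{-1 + κ}`. -/
def growth (κ : ℝ) (T : ℕ) : ℝ :=
  if κ = 0 then Real.log (1 + (T : ℝ)) else ((1 + (T : ℝ)) ^ κ - 1) / κ

theorem growth_pos {κ : ℝ} (hκ : 0 ≤ κ) {T : ℕ} (hT : T ≠ 0) : 0 < growth κ T := by
  have hT' : (0 : ℝ) < T := by exact_mod_cast Nat.pos_of_ne_zero hT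
  unfold growth
  split_ifs with h
  · exact Real.log_pos (by linarith)
  · have hκ' : 0 < κ := lt_of_le_of_ne hκ (Ne.symm h)
    have := Real.one_lt_rpow (by linarith : (1 : ℝ) < 1 + T) hκ'
    exact div_pos (by linarith) hκ'

theorem tendsto_growth {κ : ℝ} (hκ : 0 ≤ κ) : Tendsto (growth κ) atTop atTop := by
  have h1 : Tendsto (fun T : ℕ => 1 + (T : ℝ)) atTop atTop :=
    tendsto_atTop_add_const_left _ _ tendsto_natCast_atTop_atTop
  unfold growth
  split_ifs with h
  · exact Real.tendsto_log_atTop.comp h1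
  · have hκ' : 0 < κ := lt_of_le_of_ne hκ (Ne.symm h)
    refine Tendsto.atTop_div_const hκ' ?_
    simp only [sub_eq_add_neg]
    exact tendsto_atTop_add_const_right _ _ ((tendsto_rpow_atTop hκ').comp h1)

/-- Each increment of `growth` is at most the new weight: by `log (1 + s) ≤ s` for `κ = 0`, and by
Bernoulli's inequality for concave powers otherwise, with `s = 1 / (1 + T)`. -/
theorem growth_le_sum_decay {κ : ℝ} (hκ₀ : 0 ≤ κ) (hκ₁ : κ ≤ 1) (T : ℕ) :
    growth κ T ≤ ∑ t ∈ Finset.range T, decay κ t := by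
  induction T with
  | zero => simp [growth]
  | succ T ih =>
    rw [Finset.sum_range_succ]
    refine le_trans ?_ (add_le_add_left ih _)
    have hT : (0 : ℝ) < 1 + T := by positivity
    have hT2 : (1 : ℝ) + (T + 1 : ℕ) = (1 + T) * (1 + 1 / (1 + T)) := by
      push_cast
      field_simp
      ring
    have hT3 : (0 : ℝ) < 1 + 1 / (1 + T) := by positivity
    unfold growth decay
    rw [hT2]
    split_ifs with h
    · rw [Real.log_mul hT.ne' hT3.ne', h, add_zero, Real.rpow_neg_one]
      have := Real.log_le_sub_one_of_pos hT3
      rw [one_div] at this ⊢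
      linarith
    · have hκ' : 0 < κ := lt_of_le_of_ne hκ₀ (Ne.symm h)
      have h1 := rpow_one_add_le_one_add_mul_self (s := 1 / (1 + (T : ℝ)))
        (by linarith [(by positivity : (0 : ℝ) ≤ 1 / (1 + T))]) hκ₀ hκ₁
      have h2 : (1 + (T : ℝ)) ^ (-1 + κ) = (1 + (T : ℝ)) ^ κ * (1 / (1 + (T : ℝ))) := by
        rw [neg_add_eq_sub, Real.rpow_sub_one hT.ne']
        ring
      rw [Real.mul_rpow hT.le hT3.le, h2]
      have h3 : 0 < (1 + (T : ℝ)) ^ κ := by positivity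
      rw [div_le_iff₀ hκ', add_mul, div_mul_cancel₀ _ h]
      nlinarith

theorem inf'_mul_growth_le {κ : ℝ} (hκ₀ : 0 ≤ κ) (hκ₁ : κ ≤ 1) {a : ℕ → ℝ} (ha : ∀ t, 0 ≤ a t)
    {T : ℕ} (hT : (Finset.range T).Nonempty) :
    growth κ T * (Finset.range T).inf' hT a ≤ ∑ t ∈ Finset.range T, decay κ t * a t := by
  calc growth κ T * (Finset.range T).inf' hT a
      ≤ (∑ t ∈ Finset.range T, decay κ t) * (Finset.range T).inf' hT a := by
        gcongr
        · exact Finset.le_inf' _ _ fun t _ => ha t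
        · exact growth_le_sum_decay hκ₀ hκ₁ T
    _ = ∑ t ∈ Finset.range T, decay κ t * (Finset.range T).inf' hT a := Finset.sum_mul _ _ _
    _ ≤ _ := by
      gcongr with t ht
      · exact (decay_pos κ t).le
      · exact Finset.inf'_le _ ht

theorem not_summable_decay {κ : ℝ} (hκ₀ : 0 ≤ κ) (hκ₁ : κ ≤ 1) : ¬ Summable (decay κ) := by
  intro h
  obtain ⟨T, hT⟩ := ((tendsto_growth hκ₀).eventually_gt_atTop (∑' t, decay κ t)).exists
  exact absurd ((growth_le_sum_decay hκ₀ hκ₁ T).trans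
    (h.sum_le_tsum _ fun t _ => (decay_pos κ t).le)) (not_le.2 hT)

/-- A positive infimum would make the weights themselves summable. -/
theorem iInf_eq_zero_of_summable {κ : ℝ} (hκ₀ : 0 ≤ κ) (hκ₁ : κ ≤ 1) {a : ℕ → ℝ}
    (ha : ∀ t, 0 ≤ a t) (h : Summable fun t => decay κ t * a t) : ⨅ t, a t = 0 := by
  have hbdd : BddBelow (Set.range a) := ⟨0, by rintro _ ⟨t, rfl⟩; exact ha t⟩
  refine le_antisymm (not_lt.1 fun hpos => not_summable_decay hκ₀ hκ₁ ?_) (le_ciInf ha)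
  refine Summable.of_nonneg_of_le (fun t => (decay_pos κ t).le) (fun t => ?_)
    (h.mul_right (⨅ t, a t)⁻¹)
  rw [mul_assoc]
  refine le_mul_of_one_le_right (decay_pos κ t).le ?_
  rw [← div_eq_mul_inv, one_le_div hpos]
  exact ciInf_le hbdd t

/-- A sequence whose squares are summable with weights `m t`, and whose increments are bounded by
multiples of the weights, converges to `0` if the weights tend to `0` and are not summable. -/
theorem tendsto_zero_of_summable_weighted_sq {a m : ℕ → ℝ} {C : ℝ} (ha : ∀ t, 0 ≤ a t)
    (hm : ∀ t, 0 ≤ m t) (hs : Summable fun t => m t * a t ^ 2) (hns : ¬ Summable m)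
    (hm0 : Tendsto m atTop (𝓝 0)) (hC : 0 ≤ C) (hstep : ∀ t, a (t + 1) ≤ a t + C * m t) :
    Tendsto a atTop (𝓝 0) := by
  suffices h : ∀ δ : ℝ, 0 < δ → ∀ᶠ t in atTop, a t < 2 * δ by
    refine tendsto_order.2 ⟨fun x hx => Eventually.of_forall fun t => hx.trans_le (ha t),
      fun x hx => ?_⟩
    filter_upwards [h (x / 2) (by linarith)] with t ht
    linarith
  intro δ hδ
  -- Normalized so that `C * m t ≤ e t` whenever `a t ≥ δ / 2`.
  set e : ℕ → ℝ := fun t => 4 * C / δ ^ 2 * (m t * a t ^ 2) with he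
  have he0 : ∀ t, 0 ≤ e t := fun t => by
    have := hm t
    positivity
  have hes : Summable e := hs.mul_left _
  have h1 : ∀ᶠ t in atTop, C * m t ≤ δ / 2 := by
    have := hm0.const_mul C
    rw [mul_zero] at this
    exact this.eventually_le_const (by linarith)
  have h2 : ∀ᶠ t in atTop, ∑' k, e (k + t) < δ := (tendsto_sum_nat_add e).eventually_lt_const hδ
  -- Otherwise `m t` is eventually at most `m t * a t ^ 2 / δ ^ 2`, hence summable.
  have h3 : ∃ᶠ t in atTop, a t ≤ δ := by
    intro hev
    apply hns
    have h4 : Summable fun t => (δ ^ 2)⁻¹ * (m t * a t ^ 2) := hs.mul_left _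
    refine h4.of_norm_bounded_eventually_nat ?_
    filter_upwards [hev] with t ht
    rw [Real.norm_of_nonneg (hm t), inv_mul_eq_div, le_div_iff₀ (by positivity)]
    exact mul_le_mul_of_nonneg_left (pow_le_pow_left₀ hδ.le (not_le.1 ht).le 2) (hm t)
  have h12 := (h1.and h2)
  rw [eventually_atTop] at h12
  obtain ⟨N, hN⟩ := h12
  obtain ⟨n, hn, han⟩ := frequently_atTop.1 h3 N
  have h5 : ∀ k, max (a (n + k) - δ) 0 ≤ ∑ j ∈ Finset.range k, e (j + n) := by
    intro k
    induction k with
    | zero => simp [han]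
    | succ k ih =>
      rw [Finset.sum_range_succ]
      have hC' := (hN (n + k) (by omega)).1
      have hst := hstep (n + k)
      have hej : e (k + n) = 4 * C / δ ^ 2 * (m (n + k) * a (n + k) ^ 2) := by rw [add_comm k n]
      have he' := he0 (k + n)
      have hmax := le_max_left (a (n + k) - δ) 0
      refine max_le ?_ (add_nonneg ((le_max_right _ _).trans ih) he')
      rw [← add_assoc]
      -- Above `δ / 2` the increment is paid by `e`; below it, one step of size at most `δ / 2`
      -- cannot exceed `δ`.
      rcases le_total (δ / 2) (a (n + k)) with h | h
      · have h6 : C * m (n + k) ≤ e (k + n) := by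
          rw [hej]
          calc C * m (n + k) = 4 * C / δ ^ 2 * (m (n + k) * (δ / 2) ^ 2) := by field_simp; ring
            _ ≤ _ := by
              have := hm (n + k)
              gcongr
        linarith
      · linarith [(le_max_right (a (n + k) - δ) 0).trans ih]
  refine eventually_atTop.2 ⟨n, fun t ht => ?_⟩
  obtain ⟨k, rfl⟩ := Nat.exists_eq_add_of_le ht
  have h6 : ∑ j ∈ Finset.range k, e (j + n) ≤ ∑' j, e (j + n) :=
    ((summable_nat_add_iff n).2 hes).sum_le_tsum _ fun j _ => he0 _
  linarith [h5 k, le_max_left (a (n + k) - δ) 0, (hN n hn).2]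

/-! ### Smoothness of the gradient -/

section Smooth

variable {X : Type*} [NormedAddCommGroup X] [NormedSpace ℝ X]

theorem contDiff_shift_apply {f : X → Vec d} (hf : ∀ j, ContDiff ℝ 1 fun x => f x j) (c : Bool)
    (r : ℤ) (j : Fin d) : ContDiff ℝ 1 fun x => shift c r (f x) j := by
  unfold shift
  simp only
  split_ifs
  · exact hf _
  · exact hf _
  · exact contDiff_const

theorem contDiff_star {f : X → ℂ} (hf : ContDiff ℝ 1 f) : ContDiff ℝ 1 fun x => star (f x) :=
  Complex.conjCLE.contDiff.comp hf

variable {z v : X → Vec d} (hz : ContDiff ℝ 1 z) (hv : ContDiff ℝ 1 v)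
include hz hv

theorem contDiff_farField (r : M.R) (k : Fin d) :
    ContDiff ℝ 1 fun x => farField M r (z x) (v x) k := by
  simp only [farField_apply]
  refine ContDiff.sum fun j _ => contDiff_const.mul (ContDiff.mul ?_ ?_)
  · exact (contDiff_piLp 2).1 hz j
  · exact contDiff_shift_apply ((contDiff_piLp 2).1 hv) _ _ j

/-- `ε > 0` keeps the root in the denominator away from `0`, where it would fail to be smooth. -/
theorem contDiff_residual (hε : 0 < M.ε) (r : M.R) (k : Fin d) :
    ContDiff ℝ 1 fun x => residual M r (z x) (v x) k := by
  have h := contDiff_farField (M := M) hz hv r k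
  refine ContDiff.mul (Complex.ofRealCLM.contDiff.comp (contDiff_const.sub
    (contDiff_const.div ?_ fun x => ?_))) h
  · exact ((h.norm_sq ℝ).add contDiff_const).sqrt fun x => by positivity
  · positivity

theorem contDiff_gradZ (hε : 0 < M.ε) : ContDiff ℝ 1 fun x => gradZ M (z x) (v x) := by
  refine ContDiff.add (ContDiff.sum fun r _ => ?_) (hz.const_smul _)
  refine (contDiff_piLp 2).2 fun j => ContDiff.mul ?_ ?_
  · exact contDiff_star (contDiff_shift_apply ((contDiff_piLp 2).1 hv) _ _ j)
  · simp only [Matrix.mulVec, dotProduct]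
    exact ContDiff.sum fun k _ => contDiff_const.mul (contDiff_residual hz hv hε r k)

theorem contDiff_gradV (hε : 0 < M.ε) : ContDiff ℝ 1 fun x => gradV M (z x) (v x) := by
  refine ContDiff.add (ContDiff.sum fun r _ => ?_) (hv.const_smul _)
  refine (contDiff_piLp 2).2 fun j => contDiff_shift_apply (fun j => ContDiff.mul ?_ ?_) _ _ j
  · exact contDiff_star ((contDiff_piLp 2).1 hz j)
  · simp only [Matrix.mulVec, dotProduct]
    exact ContDiff.sum fun k _ => contDiff_const.mul (contDiff_residual hz hv hε r k)

end Smooth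

/-- For `ε > 0` the gradient is Lipschitz on bounded sets. -/
theorem exists_norm_grad_le_add (hε : 0 < M.ε) (ρ : ℝ) : ∃ C : ℝ, 0 ≤ C ∧
    ∀ z v z' v' : Vec d, ‖z‖ ≤ ρ → ‖v‖ ≤ ρ → ‖z'‖ ≤ ρ → ‖v'‖ ≤ ρ →
      ‖grad M z' v'‖ ≤ ‖grad M z v‖ + C * max ‖z' - z‖ ‖v' - v‖ := by
  have h : ContDiff ℝ 1 fun p : Vec d × Vec d => grad M p.1 p.2 :=
    (WithLp.prodContinuousLinearEquiv 2 ℝ (Vec d) (Vec d)).symm.contDiff.comp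
      ((contDiff_gradZ contDiff_fst contDiff_snd hε).prodMk
        (contDiff_gradV contDiff_fst contDiff_snd hε))
  obtain ⟨K, hK⟩ := h.contDiffOn.exists_lipschitzOnWith one_ne_zero
    (convex_closedBall (0 : Vec d × Vec d) ρ) (isCompact_closedBall _ _)
  refine ⟨K, K.2, fun z v z' v' hz hv hz' hv' => ?_⟩
  have h1 := hK.dist_le_mul (z', v') (by simp [Prod.norm_def, hz', hv'])
    (z, v) (by simp [Prod.norm_def, hz, hv])
  rw [dist_eq_norm, dist_eq_norm, Prod.mk_sub_mk, Prod.norm_mk] at h1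
  linarith [norm_le_norm_add_norm_sub' (grad M z' v') (grad M z v)]

/-! ### Lower bounds for the maximal step size -/

theorem ofReal_rpow_neg_le_ofReal_rpow_neg {a b q : ℝ} (hb : 0 < b) (hab : a ≤ b) (hq : 0 ≤ q) :
    ENNReal.ofReal (b ^ (-q)) ≤ ENNReal.ofReal a ^ (-q) := by
  rw [← ENNReal.ofReal_rpow_of_pos hb, ENNReal.rpow_neg, ENNReal.rpow_neg, ENNReal.inv_le_inv]
  exact ENNReal.rpow_le_rpow (ENNReal.ofReal_le_ofReal hab) hq

theorem one_le_batchBound (K : ℕ) {θ : ℝ} (hθ : 0 ≤ θ) : 1 ≤ batchBound K θ := by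
  unfold batchBound
  split_ifs
  · exact le_top
  · have h := ofReal_rpow_neg_le_ofReal_rpow_neg (a := 1 - 1 / (K : ℝ)) (b := 1) (q := 1 / θ)
      one_pos (by linarith [(by positivity : (0 : ℝ) ≤ 1 / K)]) (by positivity)
    simpa using h

namespace Model.Admissible

variable (hM : M.Admissible)
include hM

theorem exists_B_le (ρ : ℝ) : ∃ b : ℝ, 1 ≤ b ∧ ∀ z v : Vec d, ‖z‖ ≤ ρ → ‖v‖ ≤ ρ →
    B M z v ≤ b ∧ Bz M z v ≤ b ∧ Bv M z v ≤ b := by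
  have hα := hM.αT_nonneg
  have hβ := hM.βT_nonneg
  have hp := hM.pMin_pos
  refine ⟨max 1 (max (3 * (d : ℝ) * (10 / 3 * ρ ^ 2 + 10 / 3 * ρ ^ 2 + √(yNorm M)) +
      3 * max M.αT M.βT)
    (max (√(15 / 4 * (d : ℝ)) * ((d : ℝ) * ρ / (√(M.K : ℝ) * pMin M) *
        (ρ * ρ + √(yNorm M)) + M.αT * ρ))
      (√(15 / 4 * (d : ℝ)) * ((d : ℝ) * ρ / (√(M.K : ℝ) * pMin M) *
        (ρ * ρ + √(yNorm M)) + M.βT * ρ)))),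
    le_max_left _ _, fun z v hz hv => ⟨?_, ?_, ?_⟩⟩
  · refine le_max_of_le_right (le_max_of_le_left ?_)
    unfold B
    gcongr
  · refine le_max_of_le_right (le_max_of_le_right (le_max_of_le_left ?_))
    have := (norm_nonneg z).trans hz
    unfold Bz
    gcongr
  · refine le_max_of_le_right (le_max_of_le_right (le_max_of_le_right ?_))
    have := (norm_nonneg z).trans hz
    unfold Bv
    gcongr

/-- Guarantees that passing to `toReal` does not turn an infinite bound into `0`. -/
theorem stepMax_ne_top (hα : 0 < M.αT) (θ κ : ℝ) (t : ℕ) (z v : Vec d) :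
    stepMax M θ κ t z v ≠ ∞ := by
  have hB : 0 < B M z v := hα.trans_le ((le_max_left _ _).trans (hM.max_le_B z v))
  refine ne_top_of_le_ne_top ?_ (min_le_left _ _)
  rw [ENNReal.ofReal_rpow_of_pos hB]
  exact ENNReal.mul_ne_top ENNReal.ofReal_ne_top ENNReal.ofReal_ne_top

theorem exists_decay_le_stepMax (hα : 0 < M.αT) {θ κ : ℝ} (hθ₀ : 0 ≤ θ) (hθ₁ : θ < 1)
    (hκ : κ ≤ 1) (ρ : ℝ) : ∃ c : ℝ, 0 < c ∧ ∀ t, ∀ z v : Vec d, ‖z‖ ≤ ρ → ‖v‖ ≤ ρ →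
      c * decay κ t ≤ (stepMax M θ κ t z v).toReal := by
  obtain ⟨b, hb, hbB⟩ := hM.exists_B_le ρ
  have hb0 : 0 < b := one_pos.trans_le hb
  have hp : 0 ≤ 1 / (1 - θ) := div_nonneg zero_le_one (by linarith)
  have hq : 0 ≤ 2 / (3 - θ) := div_nonneg zero_le_two (by linarith)
  set c₁ : ℝ := b ^ (-(1 / (1 - θ)))
  set c₂ : ℝ := b ^ (-(2 / (3 - θ)))
  have hc₁ : 0 < c₁ := by positivity
  have hc₂ : 0 < c₂ := by positivity
  have hc₁' : c₁ ≤ 1 := Real.rpow_le_one_of_one_le_of_nonpos hb (by linarith)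
  have hc₂' : c₂ ≤ 1 := Real.rpow_le_one_of_one_le_of_nonpos hb (by linarith)
  -- `c₁`, `c₂` and the decay factor are all at most `1`, using `b ≥ 1`, so their product lies below
  -- every term of the minimum.
  refine ⟨c₁ * c₂, by positivity, fun t z v hz hv => ?_⟩
  obtain ⟨h1, h2, h3⟩ := hbB z v hz hv
  have hs := decay_pos κ t
  have hs1 := decay_le_one hκ t
  have hle₁ : c₁ * c₂ * decay κ t ≤ decay κ t * c₁ := by
    calc c₁ * c₂ * decay κ t ≤ c₁ * 1 * decay κ t := by gcongr
      _ = _ := by ring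
  have hle₂ : c₁ * c₂ * decay κ t ≤ c₂ := by
    calc c₁ * c₂ * decay κ t ≤ 1 * c₂ * 1 := by gcongr
      _ = _ := by ring
  rw [← ENNReal.ofReal_le_iff_le_toReal (hM.stepMax_ne_top hα θ κ t z v)]
  refine le_min ?_ (le_min ?_ (le_min ?_ ?_))
  · refine (ENNReal.ofReal_le_ofReal hle₁).trans ?_
    rw [ENNReal.ofReal_mul hs.le]
    exact mul_le_mul_right (ofReal_rpow_neg_le_ofReal_rpow_neg hb0 h1 hp) _
  · exact (ENNReal.ofReal_le_ofReal hle₂).trans (ofReal_rpow_neg_le_ofReal_rpow_neg hb0 h2 hq)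
  · exact (ENNReal.ofReal_le_ofReal hle₂).trans (ofReal_rpow_neg_le_ofReal_rpow_neg hb0 h3 hq)
  · refine (ENNReal.ofReal_le_ofReal (hle₂.trans hc₂')).trans ?_
    rw [ENNReal.ofReal_one]
    exact one_le_batchBound _ hθ₀

theorem exists_norm_stochGrad_le_of_bounded (ρ : ℝ) : ∃ C : ℝ, 0 ≤ C ∧ ∀ s, ∀ z v : Vec d,
    ‖z‖ ≤ ρ → ‖v‖ ≤ ρ → ‖stochGradZ M s z v‖ ≤ C ∧ ‖stochGradV M s z v‖ ≤ C := by
  obtain ⟨b, hb, hbB⟩ := hM.exists_B_le ρ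
  obtain ⟨C₁, h1, hC₁⟩ := hM.exists_norm_stochGrad_le
  obtain ⟨C₂, h2, hC₂⟩ := hM.exists_J_le_B
  refine ⟨C₁ * (√b * √(C₂ * b ^ 2)), by positivity, fun s z v hz hv => ?_⟩
  have hB0 := hM.B_nonneg z v
  have hB := (hbB z v hz hv).1
  have hJ : J M z v ≤ C₂ * b ^ 2 := (hC₂ z v).trans (by gcongr)
  have h : C₁ * (√(B M z v) * √(J M z v)) ≤ C₁ * (√b * √(C₂ * b ^ 2)) := by gcongr
  exact ⟨(hC₁ s z v).1.trans h, (hC₁ s z v).2.trans h⟩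

end Model.Admissible

/-! ### Convergence of the gradient -/

section Iteration

variable {Ω : Type*} {r : ℕ → Fin M.K → Ω → M.R} {μ ν : ℕ → Ω → ℝ} {z₀ v₀ : Vec d}
  {z v : ℕ → Ω → Vec d}

/-- If `J` is bounded along a path, then the path is bounded. -/
theorem Model.Admissible.exists_norm_le_of_tendsto_J (hM : M.Admissible) (hα : 0 < M.αT)
    (hβ : 0 < M.βT) {z v : ℕ → Vec d} {l : ℝ}
    (h : Tendsto (fun t => J M (z t) (v t)) atTop (𝓝 l)) :
    ∃ ρ : ℝ, ∀ t, ‖z t‖ ≤ ρ ∧ ‖v t‖ ≤ ρ := by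
  obtain ⟨b, hb⟩ := h.bddAbove_range
  refine ⟨max √(b / M.αT) √(b / M.βT), fun t => ⟨le_max_of_le_left ?_, le_max_of_le_right ?_⟩⟩
  · apply Real.le_sqrt_of_sq_le
    rw [le_div_iff₀ hα, mul_comm]
    exact (hM.αT_mul_le_J _ _).trans (hb ⟨t, rfl⟩)
  · apply Real.le_sqrt_of_sq_le
    rw [le_div_iff₀ hβ, mul_comm]
    exact (hM.βT_mul_le_J _ _).trans (hb ⟨t, rfl⟩)

/-- Along a bounded path, for `ε > 0`, the gradient converges to `0` as soon as its squares are
summable with the weights of the step sizes. -/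
theorem IsSGD.tendsto_grad (hM : M.Admissible) (hsgd : IsSGD M r μ ν z₀ v₀ z v) (hε : 0 < M.ε)
    {κ : ℝ} (hκ₀ : 0 ≤ κ) (hκ₁ : κ < 1) {ω : Ω} {ρ C : ℝ}
    (hρ : ∀ t, ‖z t ω‖ ≤ ρ ∧ ‖v t ω‖ ≤ ρ) (hμ : ∀ t, 0 ≤ μ t ω) (hν : ∀ t, 0 ≤ ν t ω)
    (hC : 0 ≤ C) (hμC : ∀ t, μ t ω ≤ C * decay κ t) (hνC : ∀ t, ν t ω ≤ C * decay κ t)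
    (hs : Summable fun t => decay κ t * ‖grad M (z t ω) (v t ω)‖ ^ 2) :
    Tendsto (fun t => ‖grad M (z t ω) (v t ω)‖) atTop (𝓝 0) := by
  obtain ⟨L, hL, hLip⟩ := exists_norm_grad_le_add hε ρ
  obtain ⟨G, hG, hGb⟩ := hM.exists_norm_stochGrad_le_of_bounded ρ
  have hdecay : Tendsto (decay κ) atTop (𝓝 0) := by
    have h1 : Tendsto (fun T : ℕ => 1 + (T : ℝ)) atTop atTop :=
      tendsto_atTop_add_const_left _ _ tendsto_natCast_atTop_atTop
    have h2 := (tendsto_rpow_neg_atTop (by linarith : 0 < 1 - κ)).comp h1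
    refine h2.congr fun t => ?_
    rw [decay, Function.comp_apply]
    congr 1
    ring
  refine tendsto_zero_of_summable_weighted_sq (C := L * (C * G)) (fun t => norm_nonneg _)
    (fun t => (decay_pos κ t).le) hs (not_summable_decay hκ₀ hκ₁.le) hdecay (by positivity)
    fun t => ?_
  have h1 := hLip _ _ _ _ (hρ t).1 (hρ t).2 (hρ (t + 1)).1 (hρ (t + 1)).2
  obtain ⟨hg1, hg2⟩ := hGb (fun k => r t k ω) _ _ (hρ t).1 (hρ t).2
  have hds := decay_pos κ t
  have h2 : ‖z (t + 1) ω - z t ω‖ ≤ C * G * decay κ t := by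
    rw [hsgd.z_succ, sub_sub_cancel_left, norm_neg_ofReal_smul _ (hμ t)]
    calc _ ≤ C * decay κ t * G := mul_le_mul (hμC t) hg1 (norm_nonneg _) (by positivity)
      _ = _ := by ring
  have h3 : ‖v (t + 1) ω - v t ω‖ ≤ C * G * decay κ t := by
    rw [hsgd.v_succ, sub_sub_cancel_left, norm_neg_ofReal_smul _ (hν t)]
    calc _ ≤ C * decay κ t * G := mul_le_mul (hνC t) hg2 (norm_nonneg _) (by positivity)
      _ = _ := by ring
  refine h1.trans ?_
  rw [mul_assoc L]
  gcongr
  exact max_le h2 h3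

variable [MeasurableSpace Ω] {P : Measure Ω} [IsProbabilityMeasure P]

/-- With step sizes proportional to the maximal ones, almost every path is bounded, its squared
gradients are summable with the weights `(1 + t)^{-1 + κ}`, and the step sizes are bounded by
multiples of these weights. -/
theorem IsSGD.ae_bounded_and_summable (hM : M.Admissible) (hr : IsSampling M P r)
    (hsgd : IsSGD M r μ ν z₀ v₀ z v) (hα : 0 < M.αT) (hβ : 0 < M.βT) {θ κ : ℝ} (hθ₀ : 0 ≤ θ)
    (hθ₁ : θ < 1) (hκ : κ < 1 / 2) {μ' ν' : ℝ} (hμ' : 0 < μ') (hμ'1 : μ' ≤ 1) (hν' : 0 < ν')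
    (hν'1 : ν' ≤ 1) (hμ : ∀ t ω, μ t ω = μ' * (stepMax M θ κ t (z t ω) (v t ω)).toReal)
    (hν : ∀ t ω, ν t ω = ν' * (stepMax M θ κ t (z t ω) (v t ω)).toReal) :
    ∀ᵐ ω ∂P, (∃ ρ : ℝ, ∀ t, ‖z t ω‖ ≤ ρ ∧ ‖v t ω‖ ≤ ρ) ∧
      (∃ C : ℝ, 0 ≤ C ∧ ∀ t, μ t ω ≤ C * decay κ t ∧ ν t ω ≤ C * decay κ t) ∧
      Summable fun t => decay κ t * ‖grad M (z t ω) (v t ω)‖ ^ 2 := by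
  have hdep : ∀ (c : ℝ) t, DependsOnPast r t (z t) → DependsOnPast r t (v t) →
      DependsOnPast r t fun ω => c * (stepMax M θ κ t (z t ω) (v t ω)).toReal :=
    fun c t h1 h2 => h1.comp₂ h2 fun z v => c * (stepMax M θ κ t z v).toReal
  have hd := hsgd.dependsOnPast fun t h1 h2 =>
    ⟨(funext (hμ t) : μ t = _) ▸ hdep μ' t h1 h2, (funext (hν t) : ν t = _) ▸ hdep ν' t h1 h2⟩
  have hμ0 : ∀ t ω, 0 ≤ μ t ω := fun t ω => by rw [hμ]; positivity
  have hν0 : ∀ t ω, 0 ≤ ν t ω := fun t ω => by rw [hν]; positivity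
  have hμle : ∀ t ω, μ t ω ≤ (stepMax M θ κ t (z t ω) (v t ω)).toReal := fun t ω => by
    rw [hμ]; exact mul_le_of_le_one_left ENNReal.toReal_nonneg hμ'1
  have hνle : ∀ t ω, ν t ω ≤ (stepMax M θ κ t (z t ω) (v t ω)).toReal := fun t ω => by
    rw [hν]; exact mul_le_of_le_one_left ENNReal.toReal_nonneg hν'1
  have hμm : ∀ t ω, ENNReal.ofReal (μ t ω) ≤ stepMax M θ κ t (z t ω) (v t ω) := fun t ω =>
    ENNReal.ofReal_le_of_le_toReal (hμle t ω)
  have hνm : ∀ t ω, ENNReal.ofReal (ν t ω) ≤ stepMax M θ κ t (z t ω) (v t ω) := fun t ω =>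
    ENNReal.ofReal_le_of_le_toReal (hνle t ω)
  have hb : ∀ z v, M.αT ≤ B M z v := fun z v => (le_max_left _ _).trans (hM.max_le_B z v)
  have main := hsgd.ae_tendsto_J_and_summable hM hr hθ₀ hθ₁ hκ hα hb hd
    (fun t => (funext (hμ t) : μ t = _) ▸ hdep μ' t (hd t).1 (hd t).2)
    (fun t => (funext (hν t) : ν t = _) ▸ hdep ν' t (hd t).1 (hd t).2) hμ0 hν0 hμm hνm
  filter_upwards [main] with ω ⟨⟨l, hl⟩, hs⟩
  obtain ⟨ρ, hρ⟩ := hM.exists_norm_le_of_tendsto_J hα hβ hl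
  -- The step size bound controls `τ * B` with `b₀ = αT`; dividing by `B ≥ αT` gives this constant.
  refine ⟨⟨ρ, hρ⟩, ⟨M.αT ^ (1 - 1 / (1 - θ)) / M.αT, by positivity, fun t => ?_⟩, ?_⟩
  · have key : ∀ τ : ℝ, 0 ≤ τ → ENNReal.ofReal τ ≤ stepMax M θ κ t (z t ω) (v t ω) →
        τ ≤ M.αT ^ (1 - 1 / (1 - θ)) / M.αT * decay κ t := by
      intro τ hτ h
      rw [div_mul_eq_mul_div, le_div_iff₀ hα, mul_comm (_ ^ _)]
      exact (mul_le_mul_of_nonneg_left (hb _ _) hτ).trans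
        (mul_B_le_of_le_stepMax hθ₀ hθ₁ hα (hb _ _) h)
    exact ⟨key _ (hμ0 t ω) (hμm t ω), key _ (hν0 t ω) (hνm t ω)⟩
  · obtain ⟨c, hc, hcm⟩ := hM.exists_decay_le_stepMax hα hθ₀ hθ₁ (by linarith : κ ≤ 1) ρ
    have hmin : 0 < min μ' ν' := lt_min hμ' hν'
    refine Summable.of_nonneg_of_le (fun t => mul_nonneg (decay_pos κ t).le (sq_nonneg _))
      (fun t => ?_) (hs.mul_left (2 * min μ' ν' * c)⁻¹)
    rw [inv_mul_eq_div, le_div_iff₀ (by positivity), norm_grad_sq]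
    have h1 := hcm t _ _ (hρ t).1 (hρ t).2
    have hds := decay_pos κ t
    have h2 : min μ' ν' * (c * decay κ t) ≤ μ t ω := by
      rw [hμ]
      gcongr
      exact min_le_left _ _
    have h3 : min μ' ν' * (c * decay κ t) ≤ ν t ω := by
      rw [hν]
      gcongr
      exact min_le_right _ _
    nlinarith [mul_le_mul_of_nonneg_right h2 (sq_nonneg ‖gradZ M (z t ω) (v t ω)‖),
      mul_le_mul_of_nonneg_right h3 (sq_nonneg ‖gradV M (z t ω) (v t ω)‖)]

omit [IsProbabilityMeasure P] in
-- The minimum times the sum of the weights is at most the weighted sum, which stays bounded in `T`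
-- almost surely.
theorem IsSampling.exists_measurable_inf'_le (hr : IsSampling M P r) {κ c : ℝ} (hκ₀ : 0 ≤ κ)
    (hκ₁ : κ ≤ 1) (hc : 0 < c) {a : ℕ → Ω → ℝ} (ha : ∀ t ω, 0 ≤ a t ω)
    (hd : ∀ t, DependsOnPast r t (a t)) (hs : ∀ᵐ ω ∂P, Summable fun t => decay κ t * a t ω) :
    ∃ C : Ω → ℝ, Measurable C ∧ ∀ᵐ ω ∂P, ∀ (T : ℕ) (hT : T ≠ 0),
      (Finset.range T).inf' (Finset.nonempty_range_iff.2 hT) (fun t => a t ω) ≤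
        if κ = 0 then C ω / (c * Real.log (1 + (T : ℝ)))
        else κ * C ω / (c * ((1 + (T : ℝ)) ^ κ - 1)) := by
  set F : ℕ → Ω → ℝ := fun T ω => growth κ (T + 1) *
    (Finset.range (T + 1)).inf' (Finset.nonempty_range_iff.2 T.succ_ne_zero) (fun t => a t ω)
    with hF
  have hFm : ∀ T, Measurable (F T) := by
    intro T
    refine hr.measurable_of_dependsOnPast (t := T + 1) fun ω ω' hω => ?_
    simp only [hF]
    congr 1
    exact Finset.inf'_congr _ rfl fun t ht =>
      ((hd t).mono (Finset.mem_range.1 ht).le) ω ω' hω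
  -- The supremum of `growth` times the running minimum is the smallest constant that works, and it
  -- is measurable as a countable supremum. The factor `c` only cancels the one in the stated
  -- denominator.
  refine ⟨fun ω => c * ⨆ T, F T ω, (Measurable.iSup hFm).const_mul c, ?_⟩
  filter_upwards [hs] with ω hs T hT
  have hbdd : BddAbove (Set.range fun T => F T ω) := by
    refine ⟨∑' t, decay κ t * a t ω, ?_⟩
    rintro _ ⟨T, rfl⟩
    exact (inf'_mul_growth_le hκ₀ hκ₁ (fun t => ha t ω) _).trans
      (hs.sum_le_tsum _ fun t _ => mul_nonneg (decay_pos κ t).le (ha t ω))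
  obtain ⟨T, rfl⟩ := Nat.exists_eq_succ_of_ne_zero hT
  have h1 : F T ω ≤ ⨆ T, F T ω := le_ciSup hbdd T
  have hg := growth_pos hκ₀ hT
  have h2 : (Finset.range (T + 1)).inf' (Finset.nonempty_range_iff.2 hT) (fun t => a t ω) ≤
      (⨆ T, F T ω) / growth κ (T + 1) := by
    rw [le_div_iff₀ hg, mul_comm]
    exact h1
  refine h2.trans (le_of_eq ?_)
  unfold growth
  split_ifs with h
  · rw [mul_div_mul_left _ _ hc.ne']
  · rw [mul_left_comm, mul_div_mul_left _ _ hc.ne', div_div_eq_mul_div, mul_comm κ]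

end Iteration

end Ptycho

end

/-! ### The three claims -/

theorem mainTheorem2 {d : ℕ} (hd : 0 < d) (M : Ptycho.Model d)
    (hy : ∀ r k, 0 ≤ M.y r k) (hp : ∀ r, 0 < M.p r) (hp_sum : ∑ r, M.p r = 1) (hK : 0 < M.K)
    (hε : 0 ≤ M.ε) (hα : 0 ≤ M.αT) (hβ : 0 ≤ M.βT)
    (θ κ : ℝ) (hθ₀ : 0 ≤ θ) (hθ₁ : θ < 1) (hκ : κ < θ / (1 + θ))
    {Ω : Type*} [MeasurableSpace Ω] (P : Measure Ω) [IsProbabilityMeasure P]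
    (r : ℕ → Fin M.K → Ω → M.R) (hr : Ptycho.IsSampling M P r)
    (μ ν : ℕ → Ω → ℝ) (z₀ v₀ : Ptycho.Vec d) (z v : ℕ → Ω → Ptycho.Vec d)
    (hsgd : Ptycho.IsSGD M r μ ν z₀ v₀ z v) :
    ((∀ t, Measurable[Ptycho.pastAlgebra M r t] (μ t)) →
      (∀ t, Measurable[Ptycho.pastAlgebra M r t] (ν t)) →
      (∀ t ω, 0 ≤ μ t ω) → (∀ t ω, 0 ≤ ν t ω) →
      (∀ t ω, ENNReal.ofReal (μ t ω) ≤ Ptycho.stepMax M θ κ t (z t ω) (v t ω)) →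
      (∀ t ω, ENNReal.ofReal (ν t ω) ≤ Ptycho.stepMax M θ κ t (z t ω) (v t ω)) →
      ∀ᵐ ω ∂P, ∃ l : ℝ, Tendsto (fun t => Ptycho.J M (z t ω) (v t ω)) atTop (𝓝 l)) ∧
    (0 < M.αT → 0 < M.βT → 0 < θ → 0 ≤ κ →
      ∀ μ' ν' : ℝ, 0 < μ' → μ' ≤ 1 → 0 < ν' → ν' ≤ 1 →
      (∀ t ω, μ t ω = μ' * (Ptycho.stepMax M θ κ t (z t ω) (v t ω)).toReal) →
      (∀ t ω, ν t ω = ν' * (Ptycho.stepMax M θ κ t (z t ω) (v t ω)).toReal) →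
      (∃ C₂ : Ω → ℝ, Measurable C₂ ∧ ∀ᵐ ω ∂P, ∀ (T : ℕ) (hT : T ≠ 0),
        (Finset.range T).inf' (Finset.nonempty_range_iff.2 hT)
            (fun t => ‖Ptycho.grad M (z t ω) (v t ω)‖ ^ 2) ≤
          if κ = 0 then C₂ ω / (min μ' ν' * Real.log (1 + (T : ℝ)))
          else κ * C₂ ω / (min μ' ν' * ((1 + (T : ℝ)) ^ κ - 1))) ∧
      (∀ᵐ ω ∂P, ⨅ t, ‖Ptycho.grad M (z t ω) (v t ω)‖ ^ 2 = 0) ∧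
      (0 < M.ε →
        ∀ᵐ ω ∂P, Tendsto (fun t => ‖Ptycho.grad M (z t ω) (v t ω)‖) atTop (𝓝 0))) := by
  have hM : M.Admissible := ⟨hd, hy, hp, hp_sum, hK, hε, hα, hβ⟩
  -- `θ / (1 + θ)` is below `1 / 2` since `θ < 1`; this is what makes the squared decay factors
  -- summable.
  have hκ' : κ < 1 / 2 := by
    refine hκ.trans ?_
    rw [div_lt_div_iff₀ (by linarith) two_pos]
    linarith
  refine ⟨fun hμd hνd hμ hν hμm hνm => ?_, ?_⟩
  · exact hsgd.ae_tendsto_J hM hr hθ₀ hθ₁ hκ'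
      (fun t => Ptycho.DependsOnPast.of_measurable (hμd t))
      (fun t => Ptycho.DependsOnPast.of_measurable (hνd t)) hμ hν hμm hνm
  · intro hα' hβ' _ hκ₀ μ' ν' hμ' hμ'1 hν' hν'1 hμ hν
    have main := hsgd.ae_bounded_and_summable hM hr hα' hβ' hθ₀ hθ₁ hκ' hμ' hμ'1 hν' hν'1 hμ hν
    have hzv := hsgd.dependsOnPast fun t h1 h2 =>
      ⟨(funext (hμ t) : μ t = _) ▸
        h1.comp₂ h2 fun z v => μ' * (Ptycho.stepMax M θ κ t z v).toReal,
      (funext (hν t) : ν t = _) ▸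
        h1.comp₂ h2 fun z v => ν' * (Ptycho.stepMax M θ κ t z v).toReal⟩
    refine ⟨?_, ?_, fun hε' => ?_⟩
    · exact hr.exists_measurable_inf'_le hκ₀ (by linarith) (lt_min hμ' hν')
        (fun t ω => sq_nonneg _)
        (fun t => (hzv t).1.comp₂ (hzv t).2 fun z v => ‖Ptycho.grad M z v‖ ^ 2)
        (main.mono fun ω h => h.2.2)
    · filter_upwards [main] with ω h
      exact Ptycho.iInf_eq_zero_of_summable hκ₀ (by linarith) (fun t => sq_nonneg _) h.2.2
    · filter_upwards [main] with ω ⟨⟨ρ, hρ⟩, ⟨C, hC, hCμν⟩, hs⟩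
      exact hsgd.tendsto_grad hM hε' hκ₀ (by linarith) hρ
        (fun t => by rw [hμ]; positivity) (fun t => by rw [hν]; positivity) hC
        (fun t => (hCμν t).1) (fun t => (hCμν t).2) hs
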